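/- Let $T>0$, let $(\Omega,\mathcal F,\mathbb F=(\mathcal F_t)_{t\in[0,T]},\mathbb P)$ be a filtered probability space satisfying the usual conditions, and let $U$ be a real separable Hilbert space. Let $W$ be a $U$-cylindrical $\mathbb F$-Brownian motion, i.e. a linear isometry $W:L^2([0,T],U)\to L^2(\Omega)$ with centered Gaussian values such that, for all $t\in[0,T]$ and $h\in L^2([0,T],U)$, $W(h)$ is $\mathcal F_t$-measurable if $h=0$ a.e. on $(t,T]$, and $W(h)$ is independent of $\mathcal F_t$ if $h=0$ a.e. on $[0,t]$. Let $E=C_0(\mathbb R_{>0})$ be the Banach space (with the supremum norm) of continuous functions $f:(0,\infty)\to\mathbb R$ with $\lim_{x\to0}f(x)=\lim_{x\to\infty}f(x)=0$. For $K\in\{\mathbb R,U\}$ let $C_{\mathbb F}([0,T],L^2(\Omega,K))$ be the space of continuous functions $Y:[0,T]\to L^2(\Omega,K)$ such that $Y_t$ is $\mathcal F_t$-measurable for all $t$, with the supremum norm. Write $L(\cdot,\cdot)$ for bounded linear operators with the operator norm, and $X_t(e)=X(e)_t$ for $X\in L(E,C_{\mathbb F}([0,T],L^2(\Omega,K)))$.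 Let $S:\mathbb R_{\ge0}\to L(E)$ be a strongly continuous semigroup, let $X_0\in L(E,L^2(\Omega,\mathcal F_0,\mathbb P))$, and let $$F:L(E,C_{\mathbb F}([0,T],L^2(\Omega)))\to L(E,C_{\mathbb F}([0,T],L^2(\Omega))),\qquad G:L(E,C_{\mathbb F}([0,T],L^2(\Omega)))\to L(E,C_{\mathbb F}([0,T],L^2(\Omega,U)))$$ be Lipschitz and non-anticipating, i.e. for all $t\in[0,T]$, if $X_s=Y_s$ for all $s\le t$, then $F(X)_s=F(Y)_s$ and $G(X)_s=G(Y)_s$ for all $s\le t$. Then there exists a unique $X\in L(E,C_{\mathbb F}([0,T],L^2(\Omega)))$ such that for all $t\in[0,T]$ $$X_t=S_t^*X_0+\int_0^tS_{t-s}^*F(X)_s\,ds+\int_0^tS_{t-s}^*G(X)_s\,dW_s,$$ which means that for all $t\in[0,T]$ and $e\in E$, in $L^2(\Omega)$, $$X_t(e)=X_0(S_te)+\int_0^tF(X)_s(S_{t-s}e)\,ds+\int_0^tG(X)_s(S_{t-s}e)\,dW_s,$$ with a Bochner and an Itô integral, respectively. -/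

import Mathlib

open MeasureTheory ProbabilityTheory Filter Topology
open scoped NNReal ENNReal ZeroAtInfty

noncomputable section

/-- Lebesgue measure on the time interval `[0, T]`. -/
def timeMeasure (T : ℝ) : Measure (Set.Icc (0 : ℝ) T) :=
  Measure.comap Subtype.val (volume : Measure ℝ)

instance isFiniteMeasure_timeMeasure (T : ℝ) : IsFiniteMeasure (timeMeasure T) := by
  refine ⟨?_⟩
  rw [timeMeasure, comap_subtype_coe_apply measurableSet_Icc, Set.image_univ, Subtype.range_coe]
  exact measure_Icc_lt_top

/-- The usual conditions for a filtration indexed by `[0, T]`: right-continuity, and every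
subset of a null set belongs to all `ℱ t` (in particular, the probability space is complete). -/
structure SatisfiesUsualConditions {T : ℝ} {Ω : Type*} {mΩ : MeasurableSpace Ω}
    (ℱ : Filtration (Set.Icc (0 : ℝ) T) mΩ) (P : Measure Ω) : Prop where
  rightContinuous : ℱ.IsRightContinuous
  complete : ∀ (t : Set.Icc (0 : ℝ) T) (A : Set Ω), P A = 0 → MeasurableSet[ℱ t] A

/-- A strongly continuous (`C₀`-) semigroup of bounded linear operators on `E`. -/
structure IsStronglyContinuousSemigroup {E : Type*} [NormedAddCommGroup E] [NormedSpace ℝ E]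
    (S : ℝ≥0 → E →L[ℝ] E) : Prop where
  zero : S 0 = ContinuousLinearMap.id ℝ E
  add : ∀ s t : ℝ≥0, S (s + t) = (S s).comp (S t)
  continuous : ∀ e : E, Continuous fun t : ℝ≥0 => S t e

/-- A `U`-cylindrical Brownian motion with respect to the filtration `ℱ`: a linear isometry from
`L²([0, T], U)` to `L²(Ω)` with centered Gaussian values, such that `W h` is `ℱ t`-measurable if
`h` vanishes after time `t`, and independent of `ℱ t` if `h` vanishes up to time `t`. -/
structure IsCylindricalBrownianMotion {T : ℝ} {Ω U : Type*} {mΩ : MeasurableSpace Ω}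
    [NormedAddCommGroup U] [InnerProductSpace ℝ U]
    (ℱ : Filtration (Set.Icc (0 : ℝ) T) mΩ) (P : Measure Ω)
    (W : Lp U 2 (timeMeasure T) →ₗᵢ[ℝ] Lp ℝ 2 P) : Prop where
  gaussian : ∀ h, ∃ v : ℝ≥0, P.map (W h) = gaussianReal 0 v
  adapted : ∀ (t : Set.Icc (0 : ℝ) T) (h : Lp U 2 (timeMeasure T)),
    (∀ᵐ s ∂(timeMeasure T), t < s → h s = 0) → W h ∈ lpMeas ℝ ℝ (ℱ t) 2 P
  indep : ∀ (t : Set.Icc (0 : ℝ) T) (h : Lp U 2 (timeMeasure T)),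
    (∀ᵐ s ∂(timeMeasure T), s ≤ t → h s = 0) →
      Indep (ℱ t) (MeasurableSpace.comap (W h) (borel ℝ)) P

/-- The subspace of adapted processes in `C([0, T], L²(Ω, K))`. -/
def adaptedCurves {T : ℝ} {Ω : Type*} {mΩ : MeasurableSpace Ω}
    (ℱ : Filtration (Set.Icc (0 : ℝ) T) mΩ) (P : Measure Ω)
    (K : Type*) [NormedAddCommGroup K] [NormedSpace ℝ K] :
    Submodule ℝ C(Set.Icc (0 : ℝ) T, Lp K 2 P) where
  carrier := {X | ∀ t, X t ∈ lpMeas K ℝ (ℱ t) 2 P}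
  zero_mem' := fun t => (lpMeas K ℝ (ℱ t) 2 P).zero_mem
  add_mem' := fun hX hY t => (lpMeas K ℝ (ℱ t) 2 P).add_mem (hX t) (hY t)
  smul_mem' := fun c _ hX t => (lpMeas K ℝ (ℱ t) 2 P).smul_mem c (hX t)

/-- The space `C_𝔽([0, T], L²(Ω, K))` as a type, with its supremum norm. -/
def AdaptedCurve {T : ℝ} {Ω : Type*} {mΩ : MeasurableSpace Ω}
    (ℱ : Filtration (Set.Icc (0 : ℝ) T) mΩ) (P : Measure Ω)
    (K : Type*) [NormedAddCommGroup K] [NormedSpace ℝ K] : Type _ :=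
  adaptedCurves ℱ P K

instance AdaptedCurve.instNormedAddCommGroup {T : ℝ} {Ω : Type*} {mΩ : MeasurableSpace Ω}
    (ℱ : Filtration (Set.Icc (0 : ℝ) T) mΩ) (P : Measure Ω)
    (K : Type*) [NormedAddCommGroup K] [NormedSpace ℝ K] :
    NormedAddCommGroup (AdaptedCurve ℱ P K) :=
  inferInstanceAs (NormedAddCommGroup (adaptedCurves ℱ P K))

instance AdaptedCurve.instNormedSpace {T : ℝ} {Ω : Type*} {mΩ : MeasurableSpace Ω}
    (ℱ : Filtration (Set.Icc (0 : ℝ) T) mΩ) (P : Measure Ω)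
    (K : Type*) [NormedAddCommGroup K] [NormedSpace ℝ K] :
    NormedSpace ℝ (AdaptedCurve ℱ P K) :=
  inferInstanceAs (NormedSpace ℝ (adaptedCurves ℱ P K))

/-- The Banach space `L(E, C_𝔽([0, T], L²(Ω, K)))` of `E`-cylindrical processes, with the
operator norm. -/
abbrev CylindricalProcess {T : ℝ} {Ω : Type*} {mΩ : MeasurableSpace Ω}
    (ℱ : Filtration (Set.Icc (0 : ℝ) T) mΩ) (P : Measure Ω)
    (E : Type*) [NormedAddCommGroup E] [NormedSpace ℝ E]
    (K : Type*) [NormedAddCommGroup K] [NormedSpace ℝ K] : Type _ :=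
  E →L[ℝ] AdaptedCurve ℱ P K

/-- The random variable `X_t(e)` of a cylindrical process. -/
def CylindricalProcess.eval {T : ℝ} {Ω : Type*} {mΩ : MeasurableSpace Ω}
    {ℱ : Filtration (Set.Icc (0 : ℝ) T) mΩ} {P : Measure Ω}
    {E : Type*} [NormedAddCommGroup E] [NormedSpace ℝ E]
    {K : Type*} [NormedAddCommGroup K] [NormedSpace ℝ K]
    (X : CylindricalProcess ℱ P E K) (t : Set.Icc (0 : ℝ) T) (e : E) : Lp K 2 P :=
  (X e).1 t

/-- A coefficient is non-anticipating if its values up to time `t` depend on its argument only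
up to time `t`. -/
def IsNonAnticipating {T : ℝ} {Ω : Type*} {mΩ : MeasurableSpace Ω}
    {ℱ : Filtration (Set.Icc (0 : ℝ) T) mΩ} {P : Measure Ω}
    {E : Type*} [NormedAddCommGroup E] [NormedSpace ℝ E]
    {H : Type*} [NormedAddCommGroup H] [NormedSpace ℝ H]
    {K : Type*} [NormedAddCommGroup K] [NormedSpace ℝ K]
    (Φ : CylindricalProcess ℱ P E H → CylindricalProcess ℱ P E K) : Prop :=
  ∀ (t : Set.Icc (0 : ℝ) T) (X Y : CylindricalProcess ℱ P E H),
    (∀ s ≤ t, ∀ e, X.eval s e = Y.eval s e) → ∀ s ≤ t, ∀ e, (Φ X).eval s e = (Φ Y).eval s e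

/-- A finite family of weighted predictable rectangles `(a i, b i] × A i` with `A i ∈ ℱ (a i)`
and weights `u i ∈ U`; it represents an elementary predictable process. Rectangles `{0} × A` are
omitted, as they are `dt ⊗ P`-null and contribute zero to the integral. -/
structure ElementaryProcess {T : ℝ} {Ω : Type*} {mΩ : MeasurableSpace Ω}
    (ℱ : Filtration (Set.Icc (0 : ℝ) T) mΩ) (U : Type*) where
  n : ℕ
  a : Fin n → Set.Icc (0 : ℝ) T
  b : Fin n → Set.Icc (0 : ℝ) T
  le : ∀ i, a i ≤ b i
  A : Fin n → Set Ω
  measurableSet : ∀ i, MeasurableSet[ℱ (a i)] (A i)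
  u : Fin n → U

namespace ElementaryProcess

variable {T : ℝ} {Ω U : Type*} {mΩ : MeasurableSpace Ω} {P : Measure Ω}
  {ℱ : Filtration (Set.Icc (0 : ℝ) T) mΩ} [NormedAddCommGroup U]

/-- The elementary process `∑ i, 1_{(a i, b i] × A i} u i`. -/
def val (f : ElementaryProcess ℱ U) (s : Set.Icc (0 : ℝ) T) (ω : Ω) : U :=
  ∑ i, (Set.Ioc (f.a i) (f.b i) ×ˢ f.A i).indicator (fun _ => f.u i) (s, ω)

/-- The elementary stochastic integral `∑ i, 1_{A i} W(1_{(a i, b i]} u i)`. -/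
def integral [InnerProductSpace ℝ U] (f : ElementaryProcess ℱ U)
    (W : Lp U 2 (timeMeasure T) →ₗᵢ[ℝ] Lp ℝ 2 P) (ω : Ω) : ℝ :=
  ∑ i, (f.A i).indicator
    (W (indicatorConstLp 2 (measurableSet_Ioc : MeasurableSet (Set.Ioc (f.a i) (f.b i)))
      (measure_ne_top _ _) (f.u i))) ω

end ElementaryProcess

/-- `Y` is the Itô integral `∫_0^T φ dW` of the square-integrable process
`φ : [0, T] → L²(Ω, U)`: there are elementary processes which converge to `φ` in the norm of
`L²([0, T] × Ω, U)` and whose elementary integrals converge to `Y` in `L²(Ω)`. -/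
def HasItoIntegral {T : ℝ} {Ω U : Type*} {mΩ : MeasurableSpace Ω}
    [NormedAddCommGroup U] [InnerProductSpace ℝ U]
    (ℱ : Filtration (Set.Icc (0 : ℝ) T) mΩ) (P : Measure Ω)
    (W : Lp U 2 (timeMeasure T) →ₗᵢ[ℝ] Lp ℝ 2 P)
    (φ : Set.Icc (0 : ℝ) T → Lp U 2 P) (Y : Lp ℝ 2 P) : Prop :=
  AEStronglyMeasurable φ (timeMeasure T) ∧
  ∃ f : ℕ → ElementaryProcess ℱ U,
    Tendsto (fun k => ∫⁻ s, ∫⁻ ω, ‖(f k).val s ω - φ s ω‖ₑ ^ 2 ∂P ∂(timeMeasure T)) atTop (𝓝 0) ∧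
    Tendsto (fun k => ∫⁻ ω, ‖(f k).integral W ω - Y ω‖ₑ ^ 2 ∂P) atTop (𝓝 0)

/-- `X` is a mild solution: for all `t ∈ [0, T]` and `e ∈ E`,
`X_t(e) = X₀(S_t e) + ∫_0^t F(X)_s(S_{t-s} e) ds + ∫_0^t G(X)_s(S_{t-s} e) dW_s` in `L²(Ω)`,
with a Bochner integral, an Itô integral, and `(S_r^* x)(e) = x(S_r e)`. -/
def IsMildSolution {T : ℝ} {Ω U : Type*} {mΩ : MeasurableSpace Ω}
    [NormedAddCommGroup U] [InnerProductSpace ℝ U]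
    {ℱ : Filtration (Set.Icc (0 : ℝ) T) mΩ} {P : Measure Ω}
    (W : Lp U 2 (timeMeasure T) →ₗᵢ[ℝ] Lp ℝ 2 P)
    {E : Type*} [NormedAddCommGroup E] [NormedSpace ℝ E]
    (S : ℝ≥0 → E →L[ℝ] E) (X₀ : E → Lp ℝ 2 P)
    (F : CylindricalProcess ℱ P E ℝ → CylindricalProcess ℱ P E ℝ)
    (G : CylindricalProcess ℱ P E ℝ → CylindricalProcess ℱ P E U)
    (X : CylindricalProcess ℱ P E ℝ) : Prop :=
  ∀ (t : Set.Icc (0 : ℝ) T) (e : E),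
    IntegrableOn (fun s : Set.Icc (0 : ℝ) T =>
      (F X).eval s (S (Real.toNNReal (t - s)) e)) (Set.Iic t) (timeMeasure T) ∧
    ∃ Y : Lp ℝ 2 P,
      HasItoIntegral ℱ P W
        ((Set.Iic t).indicator fun s => (G X).eval s (S (Real.toNNReal (t - s)) e)) Y ∧
      X.eval t e = X₀ (S (Real.toNNReal t) e)
        + (∫ s in Set.Iic t, (F X).eval s (S (Real.toNNReal (t - s)) e) ∂(timeMeasure T)) + Y

end

/-! The right-hand side of the mild equation defines a self-map of the Banach space `L(E, C_𝔽([0,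
T], L²(Ω)))`, and solutions are its fixed points. It contracts with respect to the weight `exp (-α
t)` for large `α`, so Banach's theorem applies.

Both integrals are treated as bounded operators `J` from `L²([0, T], L²(Ω, K))` to `L²(Ω)`. For
Itô's integral this rests on the isometry: if `B ∈ ℱ c` and `k` vanishes up to time `c`, then `E[1_B
W(h) W(k)] = P(B) ⟨h, k⟩` (`setIntegral_mul`), so the elementary integral preserves inner products.
The closure of its graph is then an isometric relation with closed domain. A continuous adapted
curve, cut off at `t`, is a limit of step functions taking their values at left endpoints, hence
lies in that domain (`cutoffL_mem_of_adapted`).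

Contraction combines two facts. A non-anticipating Lipschitz map may be evaluated at time `s` on
processes stopped at `s`, so it respects bounds of the form `k exp (α s)`
(`IsNonAnticipating.norm_eval_sub_le`). The `L²` norm of `exp (α s)` over `[0, t]` is at most `exp
(α t) / √(2 α)` (`norm_cutoffL_le_exp`), so the Lipschitz constants are multiplied by a factor that
tends to zero as `α` grows. -/

/-! ### Indicators and norms in `L²`. -/

section IndicatorLp

variable {α B : Type*} {mα : MeasurableSpace α} {μ : Measure α} [NormedAddCommGroup B]

/-- The product of an `L²` function with the indicator of a measurable set. -/
noncomputable def indicatorLp {s : Set α} (hs : MeasurableSet s) (f : Lp B 2 μ) : Lp B 2 μ :=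
  ((Lp.memLp f).indicator hs).toLp _

lemma indicatorLp_coeFn {s : Set α} (hs : MeasurableSet s) (f : Lp B 2 μ) :
    indicatorLp hs f =ᵐ[μ] s.indicator f :=
  MemLp.coeFn_toLp _

lemma indicatorLp_add_compl {s : Set α} (hs : MeasurableSet s) (f : Lp B 2 μ) :
    indicatorLp hs f + indicatorLp hs.compl f = f := by
  refine Lp.ext ?_
  filter_upwards [Lp.coeFn_add (indicatorLp hs f) (indicatorLp hs.compl f),
    indicatorLp_coeFn hs f, indicatorLp_coeFn hs.compl f] with x h1 h2 h3
  rw [h1, Pi.add_apply, h2, h3]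
  by_cases hx : x ∈ s <;> simp [hx]

lemma lintegral_enorm_sq_Lp (f : Lp B 2 μ) : ∫⁻ x, ‖f x‖ₑ ^ 2 ∂μ = ‖f‖ₑ ^ 2 := by
  have h := eLpNorm_nnreal_pow_eq_lintegral (μ := μ) (f := f) (p := 2) two_ne_zero
  rw [Lp.enorm_def]
  simpa using h.symm

lemma indicatorConstLp_smul [NormedSpace ℝ B] {s : Set α} (hs : MeasurableSet s) (hμs : μ s ≠ ∞)
    (c : ℝ) (u : B) :
    indicatorConstLp 2 hs hμs (c • u) = c • indicatorConstLp 2 hs hμs u := by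
  refine Lp.ext ?_
  filter_upwards [Lp.coeFn_smul c (indicatorConstLp 2 hs hμs u),
    indicatorConstLp_coeFn (p := 2) (hs := hs) (hμs := hμs) (c := u),
    indicatorConstLp_coeFn (p := 2) (hs := hs) (hμs := hμs) (c := c • u)] with x h1 h2 h3
  rw [h1, Pi.smul_apply, h2, h3]
  by_cases hx : x ∈ s <;> simp [hx]

/-- `indicatorConstLp` as a continuous linear map in the constant. -/
noncomputable def indicatorConstL [NormedSpace ℝ B] [IsFiniteMeasure μ] {s : Set α}
    (hs : MeasurableSet s) : B →L[ℝ] Lp B 2 μ :=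
  LinearMap.mkContinuous
    { toFun := indicatorConstLp 2 hs (measure_ne_top μ s)
      map_add' := fun _ _ => indicatorConstLp_add.symm
      map_smul' := fun c u => indicatorConstLp_smul hs _ c u }
    (μ.real s ^ (1 / (2 : ℝ≥0∞).toReal))
    fun _ => (norm_indicatorConstLp_le (hs := hs) (hμs := measure_ne_top μ s)).trans_eq
      (mul_comm _ _)

lemma indicatorLp_smul [NormedSpace ℝ B] {s : Set α} (hs : MeasurableSet s) (c : ℝ)
    (f : Lp B 2 μ) : indicatorLp hs (c • f) = c • indicatorLp hs f := by
  refine Lp.ext ?_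
  filter_upwards [Lp.coeFn_smul c (indicatorLp hs f), Lp.coeFn_smul c f,
    indicatorLp_coeFn hs f, indicatorLp_coeFn hs (c • f)] with x h1 h2 h3 h4
  rw [h1, Pi.smul_apply, h3, h4]
  by_cases hx : x ∈ s <;> simp [hx, h2]

end IndicatorLp

/-! ### Second moments of the noise on past events. -/

namespace IsCylindricalBrownianMotion

variable {T : ℝ} {Ω U : Type*} {mΩ : MeasurableSpace Ω} [NormedAddCommGroup U]
  [InnerProductSpace ℝ U] {ℱ : Filtration (Set.Icc (0 : ℝ) T) mΩ} {P : Measure Ω}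
  {W : Lp U 2 (timeMeasure T) →ₗᵢ[ℝ] Lp ℝ 2 P}

lemma integral_eq_zero (hW : IsCylindricalBrownianMotion ℱ P W) (h : Lp U 2 (timeMeasure T)) :
    ∫ ω, W h ω ∂P = 0 := by
  obtain ⟨v, hv⟩ := hW.gaussian h
  have h1 : ∫ x, x ∂(P.map (W h)) = ∫ ω, W h ω ∂P :=
    integral_map (Lp.aestronglyMeasurable _).aemeasurable aestronglyMeasurable_id
  rw [← h1, hv, integral_id_gaussianReal]

/-- The square of `W h` is a function of `W h`, hence independent of `1_B`, and its mean is `‖h‖²`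
because `W` is an isometry. -/
lemma setIntegral_sq [IsProbabilityMeasure P] (hW : IsCylindricalBrownianMotion ℱ P W)
    (c : Set.Icc (0 : ℝ) T)
    {B : Set Ω} (hB : MeasurableSet[ℱ c] B) {h : Lp U 2 (timeMeasure T)}
    (hh : ∀ᵐ s ∂(timeMeasure T), s ≤ c → h s = 0) :
    ∫ ω in B, W h ω * W h ω ∂P = P.real B * inner ℝ h h := by
  have hBm : MeasurableSet B := ℱ.le c _ hB
  have hind : IndepFun (B.indicator fun _ => (1 : ℝ)) (fun ω => W h ω * W h ω) P := by
    have h0 := hW.indep c h hh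
    refine indep_of_indep_of_le_left (indep_of_indep_of_le_right h0 ?_) ?_
    · rw [← BorelSpace.measurable_eq (α := ℝ)]
      exact Measurable.comap_le (m₁ := MeasurableSpace.comap (W h) (borel ℝ))
        ((comap_measurable (W h)).mul (comap_measurable (W h)))
    · exact Measurable.comap_le (m₁ := ℱ c) (measurable_const.indicator hB)
  have hsq : ∫ ω, W h ω * W h ω ∂P = inner ℝ h h := by
    rw [← W.inner_map_map, L2.inner_def]
    simp [sq]
  rw [← integral_indicator hBm, ← hsq, ← integral_indicator_one hBm]
  refine Eq.trans ?_ (hind.integral_fun_mul_eq_mul_integral ?_ ?_)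
  · refine integral_congr_ae (ae_of_all _ fun ω => ?_)
    by_cases hω : ω ∈ B <;> simp [hω]
  · exact (aestronglyMeasurable_const).indicator hBm
  · exact (Lp.aestronglyMeasurable _).mul (Lp.aestronglyMeasurable _)

lemma integrable_mul (h k : Lp ℝ 2 P) : Integrable (fun ω => h ω * k ω) P :=
  (Lp.memLp h).integrable_mul (Lp.memLp k)

lemma setIntegral_mul_add (B : Set Ω) (h k l : Lp ℝ 2 P) :
    ∫ ω in B, (h + k) ω * l ω ∂P = ∫ ω in B, h ω * l ω ∂P + ∫ ω in B, k ω * l ω ∂P := by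
  rw [← integral_add (integrable_mul h l).integrableOn (integrable_mul k l).integrableOn]
  refine integral_congr_ae (ae_restrict_of_ae ?_)
  filter_upwards [Lp.coeFn_add h k] with ω hω
  rw [hω, Pi.add_apply, add_mul]

lemma setIntegral_mul_comm (B : Set Ω) (h k : Lp ℝ 2 P) :
    ∫ ω in B, h ω * k ω ∂P = ∫ ω in B, k ω * h ω ∂P := by
  simp_rw [mul_comm]

/-- Independence of `ℱ c` is assumed for each single variable `W h`, not for pairs. The product `W h
* W k` is therefore reached by polarization, from the squares of `W h`, `W k` and `W (h + k)`. -/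
lemma setIntegral_mul_of_future [IsProbabilityMeasure P] (hW : IsCylindricalBrownianMotion ℱ P W)
    (c : Set.Icc (0 : ℝ) T) {B : Set Ω} (hB : MeasurableSet[ℱ c] B) {h k : Lp U 2 (timeMeasure T)}
    (hh : ∀ᵐ s ∂(timeMeasure T), s ≤ c → h s = 0) (hk : ∀ᵐ s ∂(timeMeasure T), s ≤ c → k s = 0) :
    ∫ ω in B, W h ω * W k ω ∂P = P.real B * inner ℝ h k := by
  have hhk : ∀ᵐ s ∂(timeMeasure T), s ≤ c → (h + k) s = 0 := by
    filter_upwards [hh, hk, Lp.coeFn_add h k] with s h1 h2 h3 hs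
    rw [h3, Pi.add_apply, h1 hs, h2 hs, add_zero]
  have h1 := hW.setIntegral_sq c hB hhk
  have h2 := hW.setIntegral_sq c hB hh
  have h3 := hW.setIntegral_sq c hB hk
  rw [map_add, setIntegral_mul_add, setIntegral_mul_comm B (W h), setIntegral_mul_comm B (W k),
    setIntegral_mul_add, setIntegral_mul_add, h2, h3, setIntegral_mul_comm B (W k) (W h),
    real_inner_add_add_self] at h1
  linarith

/-- Up to a null set `1_B W(h)` is `ℱ c`-measurable, so it is independent of the centered variable
`W k` and the expectation of the product factorizes. -/
lemma setIntegral_mul_of_past [IsProbabilityMeasure P] (hW : IsCylindricalBrownianMotion ℱ P W)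
    (c : Set.Icc (0 : ℝ) T) {B : Set Ω} (hB : MeasurableSet[ℱ c] B) {h k : Lp U 2 (timeMeasure T)}
    (hh : ∀ᵐ s ∂(timeMeasure T), c < s → h s = 0) (hk : ∀ᵐ s ∂(timeMeasure T), s ≤ c → k s = 0) :
    ∫ ω in B, W h ω * W k ω ∂P = 0 := by
  have hBm : MeasurableSet B := ℱ.le c _ hB
  have hm : AEStronglyMeasurable[ℱ c] (W h) P := mem_lpMeas_iff_aestronglyMeasurable.1
    (hW.adapted c h hh)
  have hind : IndepFun (B.indicator (hm.mk (W h))) (W k) P := by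
    have h0 := hW.indep c k hk
    refine indep_of_indep_of_le_left (indep_of_indep_of_le_right h0 ?_) ?_
    · rw [← BorelSpace.measurable_eq (α := ℝ)]
    · exact Measurable.comap_le (m₁ := ℱ c) (hm.stronglyMeasurable_mk.measurable.indicator hB)
  have h1 := hind.integral_fun_mul_eq_mul_integral
    ((hm.stronglyMeasurable_mk.mono (ℱ.le c)).aestronglyMeasurable.indicator hBm)
    (Lp.aestronglyMeasurable _)
  rw [hW.integral_eq_zero, mul_zero] at h1
  rw [← integral_indicator hBm]
  refine Eq.trans (integral_congr_ae ?_) h1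
  filter_upwards [hm.ae_eq_mk] with ω hω
  by_cases hωB : ω ∈ B <;> simp [hωB, hω]

lemma inner_past_future (c : Set.Icc (0 : ℝ) T) {h k : Lp U 2 (timeMeasure T)}
    (hh : ∀ᵐ s ∂(timeMeasure T), c < s → h s = 0) (hk : ∀ᵐ s ∂(timeMeasure T), s ≤ c → k s = 0) :
    inner ℝ h k = 0 := by
  rw [L2.inner_def]
  refine integral_eq_zero_of_ae ?_
  filter_upwards [hh, hk] with s h1 h2
  rcases le_or_gt s c with hs | hs
  · simp [h2 hs]
  · simp [h1 hs]

/-- Splitting `h` at time `c` leaves only its future part: the past part contributes zero on both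
sides. -/
lemma setIntegral_mul [IsProbabilityMeasure P] (hW : IsCylindricalBrownianMotion ℱ P W)
    (c : Set.Icc (0 : ℝ) T) {B : Set Ω} (hB : MeasurableSet[ℱ c] B) (h : Lp U 2 (timeMeasure T))
    {k : Lp U 2 (timeMeasure T)} (hk : ∀ᵐ s ∂(timeMeasure T), s ≤ c → k s = 0) :
    ∫ ω in B, W h ω * W k ω ∂P = P.real B * inner ℝ h k := by
  have hc : MeasurableSet (Set.Iic c) := measurableSet_Iic
  have h1 : ∀ᵐ s ∂(timeMeasure T), c < s → indicatorLp hc h s = 0 := by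
    filter_upwards [indicatorLp_coeFn hc h] with s hs hcs
    rw [hs, Set.indicator_of_notMem (by simpa using hcs)]
  have h2 : ∀ᵐ s ∂(timeMeasure T), s ≤ c → indicatorLp hc.compl h s = 0 := by
    filter_upwards [indicatorLp_coeFn hc.compl h] with s hs hcs
    rw [hs, Set.indicator_of_notMem (by simpa using hcs)]
  rw [← indicatorLp_add_compl hc h, map_add, setIntegral_mul_add, inner_add_left,
    inner_past_future c h1 hk, hW.setIntegral_mul_of_past c hB h1 hk,
    hW.setIntegral_mul_of_future c hB h2 hk, zero_add, zero_add]

end IsCylindricalBrownianMotion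

/-! ### The Itô integral as the closure of an isometric graph. -/

section Ito

variable {T : ℝ} {Ω U : Type*} {mΩ : MeasurableSpace Ω} [NormedAddCommGroup U]
  {ℱ : Filtration (Set.Icc (0 : ℝ) T) mΩ} {P : Measure Ω}

/-- The elementary process `1_{(a, b] × A} u` as a square integrable curve in `L²(Ω)`. -/
noncomputable def elementaryCurve [IsFiniteMeasure P] (a b : Set.Icc (0 : ℝ) T) {A : Set Ω}
    (hA : MeasurableSet A) (u : U) : Lp (Lp U 2 P) 2 (timeMeasure T) :=
  indicatorConstLp 2 (measurableSet_Ioc : MeasurableSet (Set.Ioc a b)) (measure_ne_top _ _)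
    (indicatorConstLp 2 hA (measure_ne_top _ _) u)

variable [InnerProductSpace ℝ U]

/-- The stochastic integral `1_A W(1_{(a, b]} u)` of the elementary process `1_{(a, b] × A} u`. -/
noncomputable def elementaryIntegral (W : Lp U 2 (timeMeasure T) →ₗᵢ[ℝ] Lp ℝ 2 P)
    (a b : Set.Icc (0 : ℝ) T) {A : Set Ω} (hA : MeasurableSet A) (u : U) : Lp ℝ 2 P :=
  indicatorLp hA (W (indicatorConstLp 2 (measurableSet_Ioc : MeasurableSet (Set.Ioc a b))
    (measure_ne_top _ _) u))

lemma inner_indicatorLp {s t : Set Ω} (hs : MeasurableSet s) (ht : MeasurableSet t)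
    (f g : Lp ℝ 2 P) :
    inner ℝ (indicatorLp hs f) (indicatorLp ht g) = ∫ ω in s ∩ t, f ω * g ω ∂P := by
  rw [L2.inner_def, ← integral_indicator (hs.inter ht)]
  refine integral_congr_ae ?_
  filter_upwards [indicatorLp_coeFn hs f, indicatorLp_coeFn ht g] with ω h1 h2
  rw [h1, h2]
  by_cases hωs : ω ∈ s <;> by_cases hωt : ω ∈ t <;> simp [hωs, hωt, mul_comm]

variable [CompleteSpace U] [IsProbabilityMeasure P]
  {W : Lp U 2 (timeMeasure T) →ₗᵢ[ℝ] Lp ℝ 2 P}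

/-- At the later starting time `a'` both events are known, so `A ∩ A' ∈ ℱ a'`, while the second
integrand vanishes up to `a'`. This is the setting of `setIntegral_mul`; the two intervals may
overlap. -/
lemma inner_elementaryIntegral_of_le (hW : IsCylindricalBrownianMotion ℱ P W)
    {a b a' b' : Set.Icc (0 : ℝ) T} {A A' : Set Ω}
    (hA : MeasurableSet[ℱ a] A) (hA' : MeasurableSet[ℱ a'] A') (u u' : U) (h : a ≤ a') :
    inner ℝ (elementaryIntegral W a b (ℱ.le a _ hA) u)
        (elementaryIntegral W a' b' (ℱ.le a' _ hA') u') =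
      inner ℝ (elementaryCurve (P := P) a b (ℱ.le a _ hA) u)
        (elementaryCurve a' b' (ℱ.le a' _ hA') u') := by
  rw [elementaryIntegral, elementaryIntegral, inner_indicatorLp,
    hW.setIntegral_mul a' ((ℱ.mono h _ hA).inter hA'), elementaryCurve, elementaryCurve,
    L2.inner_indicatorConstLp_indicatorConstLp, L2.inner_indicatorConstLp_indicatorConstLp,
    L2.inner_indicatorConstLp_indicatorConstLp]
  · simp only [smul_eq_mul]
    ring
  · filter_upwards [indicatorConstLp_coeFn (p := 2) (μ := timeMeasure T) (c := u')
      (hs := (measurableSet_Ioc : MeasurableSet (Set.Ioc a' b'))) (hμs := measure_ne_top _ _)]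
      with s hs hsa
    rw [hs, Set.indicator_of_notMem]
    exact fun h => absurd h.1 (not_lt.2 hsa)

lemma inner_elementaryIntegral (hW : IsCylindricalBrownianMotion ℱ P W)
    {a b a' b' : Set.Icc (0 : ℝ) T} {A A' : Set Ω}
    (hA : MeasurableSet[ℱ a] A) (hA' : MeasurableSet[ℱ a'] A') (u u' : U) :
    inner ℝ (elementaryIntegral W a b (ℱ.le a _ hA) u)
        (elementaryIntegral W a' b' (ℱ.le a' _ hA') u') =
      inner ℝ (elementaryCurve (P := P) a b (ℱ.le a _ hA) u)
        (elementaryCurve a' b' (ℱ.le a' _ hA') u') := by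
  rcases le_total a a' with h | h
  · exact inner_elementaryIntegral_of_le hW hA hA' u u' h
  · rw [real_inner_comm, inner_elementaryIntegral_of_le hW hA' hA u' u h, real_inner_comm]

variable (ℱ W) in
/-- Pairs of an elementary process supported on one rectangle and its stochastic integral. -/
def elementaryPairs : Set (Lp (Lp U 2 P) 2 (timeMeasure T) × Lp ℝ 2 P) :=
  {x | ∃ (a b : Set.Icc (0 : ℝ) T) (A : Set Ω) (hA : MeasurableSet[ℱ a] A) (u : U), a ≤ b ∧
    x = (elementaryCurve a b (ℱ.le a _ hA) u, elementaryIntegral W a b (ℱ.le a _ hA) u)}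

variable (ℱ W) in
/-- The graph of the Itô integral: the closure of the graph of the elementary integral. -/
noncomputable def itoGraph : Submodule ℝ (Lp (Lp U 2 P) 2 (timeMeasure T) × Lp ℝ 2 P) :=
  (Submodule.span ℝ (elementaryPairs ℱ W)).topologicalClosure

/-- By bilinearity, agreement of the inner products on generators passes to all linear combinations.
No orthogonality of the generators, and no common refinement of the rectangles, is needed. -/
lemma norm_eq_of_mem_span {H H' : Type*} [NormedAddCommGroup H] [InnerProductSpace ℝ H]
    [NormedAddCommGroup H'] [InnerProductSpace ℝ H'] {s : Set (H × H')}
    (hs : ∀ x ∈ s, ∀ y ∈ s, inner ℝ x.2 y.2 = inner ℝ x.1 y.1) {x : H × H'}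
    (hx : x ∈ Submodule.span ℝ s) : ‖x.2‖ = ‖x.1‖ := by
  obtain ⟨n, f, g, rfl⟩ := Submodule.mem_span_set'.1 hx
  have h : inner ℝ (∑ i, f i • (g i : H × H')).2 (∑ i, f i • (g i : H × H')).2 =
      inner ℝ (∑ i, f i • (g i : H × H')).1 (∑ i, f i • (g i : H × H')).1 := by
    simp only [Prod.snd_sum, Prod.fst_sum, Prod.smul_fst, Prod.smul_snd, sum_inner, inner_sum,
      real_inner_smul_left, real_inner_smul_right, hs _ (g _).2 _ (g _).2]
  rw [real_inner_self_eq_norm_sq, real_inner_self_eq_norm_sq] at h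
  exact (sq_eq_sq₀ (norm_nonneg _) (norm_nonneg _)).1 h

lemma norm_eq_of_mem_itoGraph (hW : IsCylindricalBrownianMotion ℱ P W)
    {x : Lp (Lp U 2 P) 2 (timeMeasure T) × Lp ℝ 2 P} (hx : x ∈ itoGraph ℱ W) :
    ‖x.2‖ = ‖x.1‖ := by
  have hcl : IsClosed {x : Lp (Lp U 2 P) 2 (timeMeasure T) × Lp ℝ 2 P | ‖x.2‖ = ‖x.1‖} :=
    isClosed_eq (by fun_prop) (by fun_prop)
  refine hcl.closure_subset_iff.2 (fun y hy => ?_) hx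
  refine norm_eq_of_mem_span ?_ hy
  rintro _ ⟨a, b, A, hA, u, -, rfl⟩ _ ⟨a', b', A', hA', u', -, rfl⟩
  exact inner_elementaryIntegral hW hA hA' u u'

/-- A closed isometric relation between Hilbert spaces has a closed domain and extends to a bounded
operator. -/
lemma exists_operator_of_isometric_graph {H H' : Type*} [NormedAddCommGroup H]
    [InnerProductSpace ℝ H] [CompleteSpace H] [NormedAddCommGroup H'] [InnerProductSpace ℝ H']
    [CompleteSpace H'] (Γ : Submodule ℝ (H × H')) (hΓ : IsClosed (Γ : Set (H × H')))
    (hnorm : ∀ x ∈ Γ, ‖x.2‖ = ‖x.1‖) :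
    IsClosed (Γ.map (LinearMap.fst ℝ H H') : Set H) ∧
      ∃ I : H →L[ℝ] H', ∀ x ∈ Γ, I x.1 = x.2 := by
  have : CompleteSpace Γ := hΓ.completeSpace_coe
  -- The product carries the maximum norm, and the two components of a point of `Γ` have equal
  -- norms, so the first projection is isometric on `Γ`.
  let p : Γ →ₗᵢ[ℝ] H :=
    { toLinearMap := LinearMap.fst ℝ _ _ ∘ₗ Γ.subtype
      norm_map' := fun x => by
        change ‖x.1.1‖ = ‖x.1‖
        rw [Prod.norm_def, hnorm _ x.2, max_self] }
  have hrange : IsComplete (LinearMap.range p.toLinearMap : Set H) := by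
    rw [LinearMap.coe_range]
    exact p.isometry.isUniformInducing.isComplete_range
  have : CompleteSpace (LinearMap.range p.toLinearMap) := hrange.completeSpace_coe
  constructor
  · convert hrange.isClosed using 1
    ext v
    simp [p]
  -- The operator vanishes on the orthogonal complement of the domain; only its values on the domain
  -- carry meaning.
  · refine ⟨(ContinuousLinearMap.snd ℝ _ _ ∘L Γ.subtypeL) ∘L
      (p.equivRange.symm.toContinuousLinearEquiv.toContinuousLinearMap ∘L
        (LinearMap.range p.toLinearMap).orthogonalProjectionOnto), fun x hx => ?_⟩
    have h1 : (LinearMap.range p.toLinearMap).orthogonalProjectionOnto x.1 =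
        p.equivRange ⟨x, hx⟩ :=
      Submodule.orthogonalProjectionOnto_mem_subspace_eq_self (p.equivRange ⟨x, hx⟩)
    change (p.equivRange.symm ((LinearMap.range p.toLinearMap).orthogonalProjectionOnto x.1)).1.2
      = x.2
    rw [h1, LinearIsometryEquiv.symm_apply_apply]

variable (ℱ W) in
/-- The space of Itô integrable processes. -/
noncomputable def itoDomain : Submodule ℝ (Lp (Lp U 2 P) 2 (timeMeasure T)) :=
  (itoGraph ℱ W).map (LinearMap.fst ℝ _ _)

lemma isClosed_itoDomain (hW : IsCylindricalBrownianMotion ℱ P W) :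
    IsClosed (itoDomain ℱ W : Set (Lp (Lp U 2 P) 2 (timeMeasure T))) :=
  (exists_operator_of_isometric_graph (itoGraph ℱ W) (Submodule.isClosed_topologicalClosure _)
    fun _ hx => norm_eq_of_mem_itoGraph hW hx).1

/-- The Itô integral, extended to a bounded operator on all square integrable curves. -/
noncomputable def itoIntegral (hW : IsCylindricalBrownianMotion ℱ P W) :
    Lp (Lp U 2 P) 2 (timeMeasure T) →L[ℝ] Lp ℝ 2 P :=
  (exists_operator_of_isometric_graph (itoGraph ℱ W) (Submodule.isClosed_topologicalClosure _)
    fun _ hx => norm_eq_of_mem_itoGraph hW hx).2.choose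

lemma itoIntegral_eq_of_mem (hW : IsCylindricalBrownianMotion ℱ P W)
    {x : Lp (Lp U 2 P) 2 (timeMeasure T) × Lp ℝ 2 P} (hx : x ∈ itoGraph ℱ W) :
    itoIntegral hW x.1 = x.2 :=
  (exists_operator_of_isometric_graph (itoGraph ℱ W) (Submodule.isClosed_topologicalClosure _)
    fun _ hx => norm_eq_of_mem_itoGraph hW hx).2.choose_spec x hx

lemma mem_itoGraph_of_mem_itoDomain (hW : IsCylindricalBrownianMotion ℱ P W)
    {v : Lp (Lp U 2 P) 2 (timeMeasure T)} (hv : v ∈ itoDomain ℱ W) :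
    (v, itoIntegral hW v) ∈ itoGraph ℱ W := by
  obtain ⟨x, hx, rfl⟩ := hv
  have h := itoIntegral_eq_of_mem hW hx
  change (x.1, itoIntegral hW x.1) ∈ _
  rw [h]
  exact hx

omit [CompleteSpace U] in
lemma elementaryCurve_mem_itoDomain {a b : Set.Icc (0 : ℝ) T} (hab : a ≤ b) {A : Set Ω}
    (hA : MeasurableSet[ℱ a] A) (u : U) :
    elementaryCurve a b (ℱ.le a _ hA) u ∈ itoDomain ℱ W :=
  ⟨_, Submodule.le_topologicalClosure _ (Submodule.subset_span ⟨a, b, A, hA, u, hab, rfl⟩), rfl⟩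

lemma itoIntegral_elementaryCurve (hW : IsCylindricalBrownianMotion ℱ P W)
    {a b : Set.Icc (0 : ℝ) T} (hab : a ≤ b) {A : Set Ω} (hA : MeasurableSet[ℱ a] A) (u : U) :
    itoIntegral hW (elementaryCurve a b (ℱ.le a _ hA) u) =
      elementaryIntegral W a b (ℱ.le a _ hA) u :=
  itoIntegral_eq_of_mem hW (x := (_, _))
    (Submodule.le_topologicalClosure _ (Submodule.subset_span ⟨a, b, A, hA, u, hab, rfl⟩))

omit [CompleteSpace U] [IsProbabilityMeasure P] in
lemma elementaryIntegral_mem_lpMeas (hW : IsCylindricalBrownianMotion ℱ P W)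
    {a b t : Set.Icc (0 : ℝ) T} (hab : a ≤ b) (hbt : b ≤ t) {A : Set Ω}
    (hA : MeasurableSet[ℱ a] A) (u : U) :
    elementaryIntegral W a b (ℱ.le a _ hA) u ∈ lpMeas ℝ ℝ (ℱ t) 2 P := by
  have h := hW.adapted t (indicatorConstLp 2 (measurableSet_Ioc : MeasurableSet (Set.Ioc a b))
    (measure_ne_top _ _) u) (by
      filter_upwards [indicatorConstLp_coeFn (p := 2) (μ := timeMeasure T) (c := u)
        (hs := (measurableSet_Ioc : MeasurableSet (Set.Ioc a b))) (hμs := measure_ne_top _ _)]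
        with s hs hts
      rw [hs, Set.indicator_of_notMem]
      exact fun h => absurd (h.2.trans hbt) (not_le.2 hts))
  rw [mem_lpMeas_iff_aestronglyMeasurable] at h ⊢
  refine ⟨A.indicator (h.mk _), h.stronglyMeasurable_mk.indicator (ℱ.mono (hab.trans hbt) _ hA),
    (indicatorLp_coeFn _ _).trans ?_⟩
  filter_upwards [h.ae_eq_mk] with ω hω
  by_cases hωA : ω ∈ A <;> simp [hωA, hω]

/-! ### Elementary processes as the span of single rectangles. -/

namespace ElementaryProcess

/-- An elementary process as a square integrable curve in `L²(Ω)`. -/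
noncomputable def toLp (P : Measure Ω) [IsProbabilityMeasure P] (f : ElementaryProcess ℱ U) :
    Lp (Lp U 2 P) 2 (timeMeasure T) :=
  ∑ i, elementaryCurve (f.a i) (f.b i) (ℱ.le _ _ (f.measurableSet i)) (f.u i)

/-- The elementary stochastic integral as an element of `L²(Ω)`. -/
noncomputable def integralLp (f : ElementaryProcess ℱ U)
    (W : Lp U 2 (timeMeasure T) →ₗᵢ[ℝ] Lp ℝ 2 P) : Lp ℝ 2 P :=
  ∑ i, elementaryIntegral W (f.a i) (f.b i) (ℱ.le _ _ (f.measurableSet i)) (f.u i)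

omit [CompleteSpace U] in
lemma mem_span (f : ElementaryProcess ℱ U) :
    (f.toLp P, f.integralLp W) ∈ Submodule.span ℝ (elementaryPairs ℱ W) := by
  have : (f.toLp P, f.integralLp W) = ∑ i,
      (elementaryCurve (f.a i) (f.b i) (ℱ.le _ _ (f.measurableSet i)) (f.u i),
        elementaryIntegral W (f.a i) (f.b i) (ℱ.le _ _ (f.measurableSet i)) (f.u i)) := by
    ext1 <;> simp [toLp, integralLp, Prod.fst_sum, Prod.snd_sum]
  rw [this]
  exact Submodule.sum_mem _ fun i _ =>
    Submodule.subset_span ⟨_, _, _, f.measurableSet i, _, f.le i, rfl⟩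

omit [CompleteSpace U] in
-- The coefficients of a linear combination are absorbed into the weights `u i`.
lemma exists_of_mem_span {x : Lp (Lp U 2 P) 2 (timeMeasure T) × Lp ℝ 2 P}
    (hx : x ∈ Submodule.span ℝ (elementaryPairs ℱ W)) :
    ∃ f : ElementaryProcess ℱ U, (f.toLp P, f.integralLp W) = x := by
  obtain ⟨n, c, g, rfl⟩ := Submodule.mem_span_set'.1 hx
  choose a b A hA u hab hg using fun i => (g i).2
  refine ⟨⟨n, a, b, hab, A, hA, fun i => c i • u i⟩, ?_⟩
  have h1 : ∀ i, elementaryCurve (P := P) (a i) (b i) (ℱ.le _ _ (hA i)) (c i • u i) =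
      c i • elementaryCurve (P := P) (a i) (b i) (ℱ.le _ _ (hA i)) (u i) := fun i => by
    rw [elementaryCurve, indicatorConstLp_smul, indicatorConstLp_smul, elementaryCurve]
  have h2 : ∀ i, elementaryIntegral W (a i) (b i) (ℱ.le _ _ (hA i)) (c i • u i) =
      c i • elementaryIntegral W (a i) (b i) (ℱ.le _ _ (hA i)) (u i) := fun i => by
    rw [elementaryIntegral, indicatorConstLp_smul, map_smul, indicatorLp_smul, elementaryIntegral]
  ext1
  · simp only [toLp, Prod.fst_sum, Prod.smul_fst, h1]
    exact Finset.sum_congr rfl fun i _ => by rw [hg i]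
  · simp only [integralLp, Prod.snd_sum, Prod.smul_snd, h2]
    exact Finset.sum_congr rfl fun i _ => by rw [hg i]

omit [CompleteSpace U] [IsProbabilityMeasure P] in
lemma integral_ae_eq (f : ElementaryProcess ℱ U) : f.integral W =ᵐ[P] f.integralLp W := by
  have h1 : ∀ᵐ ω ∂P, ∀ i, elementaryIntegral W (f.a i) (f.b i) (ℱ.le _ _ (f.measurableSet i))
      (f.u i) ω = (f.A i).indicator (W (indicatorConstLp 2
        (measurableSet_Ioc : MeasurableSet (Set.Ioc (f.a i) (f.b i)))
        (measure_ne_top _ _) (f.u i))) ω :=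
    ae_all_iff.2 fun i => indicatorLp_coeFn _ _
  filter_upwards [h1, Lp.coeFn_finsetSum Finset.univ fun i => elementaryIntegral W (f.a i) (f.b i)
    (ℱ.le _ _ (f.measurableSet i)) (f.u i)] with ω h1 h2
  rw [integralLp, h2, Finset.sum_apply]
  simp only [h1]
  rfl

omit [InnerProductSpace ℝ U] [CompleteSpace U] in
lemma toLp_ae_eq (f : ElementaryProcess ℱ U) :
    ∀ᵐ s ∂(timeMeasure T), f.val s =ᵐ[P] (f.toLp P s : Lp U 2 P) := by
  have h1 : ∀ᵐ s ∂(timeMeasure T), ∀ i, elementaryCurve (P := P) (f.a i) (f.b i)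
      (ℱ.le _ _ (f.measurableSet i)) (f.u i) s = (Set.Ioc (f.a i) (f.b i)).indicator
        (fun _ => indicatorConstLp 2 (ℱ.le _ _ (f.measurableSet i)) (measure_ne_top P _) (f.u i))
        s :=
    ae_all_iff.2 fun i => indicatorConstLp_coeFn
  filter_upwards [h1, Lp.coeFn_finsetSum Finset.univ fun i => elementaryCurve (P := P) (f.a i)
    (f.b i) (ℱ.le _ _ (f.measurableSet i)) (f.u i)] with s h1 h2
  rw [toLp, h2, Finset.sum_apply]
  simp only [h1]
  have h3 : ∀ᵐ ω ∂P, ∀ i, ((Set.Ioc (f.a i) (f.b i)).indicator (fun _ => indicatorConstLp 2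
      (ℱ.le _ _ (f.measurableSet i)) (measure_ne_top P _) (f.u i)) s : Lp U 2 P) ω =
      (Set.Ioc (f.a i) (f.b i) ×ˢ f.A i).indicator (fun _ => f.u i) (s, ω) := by
    refine ae_all_iff.2 fun i => ?_
    by_cases hs : s ∈ Set.Ioc (f.a i) (f.b i)
    · simp only [Set.indicator_of_mem hs]
      filter_upwards [indicatorConstLp_coeFn (p := 2) (hs := ℱ.le _ _ (f.measurableSet i))
        (hμs := measure_ne_top P _) (c := f.u i)] with ω hω
      rw [hω]
      by_cases hωA : ω ∈ f.A i
      · rw [Set.indicator_of_mem hωA, Set.indicator_of_mem (Set.mk_mem_prod hs hωA)]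
      · rw [Set.indicator_of_notMem hωA, Set.indicator_of_notMem fun h => hωA h.2]
    · simp only [Set.indicator_of_notMem hs]
      filter_upwards [Lp.coeFn_zero U 2 P] with ω hω
      rw [hω, Set.indicator_of_notMem fun h => hs h.1, Pi.zero_apply]
  filter_upwards [h3, Lp.coeFn_finsetSum Finset.univ fun i => (Set.Ioc (f.a i) (f.b i)).indicator
    (fun _ => indicatorConstLp 2 (ℱ.le _ _ (f.measurableSet i)) (measure_ne_top P _) (f.u i)) s]
    with ω h3 h4
  rw [h4, Finset.sum_apply]
  simp only [h3]
  rfl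

end ElementaryProcess

lemma tendsto_enorm_sub_sq_iff {B : Type*} [NormedAddCommGroup B] {ι : Type*} {l : Filter ι}
    {x : ι → B} {y : B} :
    Tendsto (fun k => ‖x k - y‖ₑ ^ 2) l (𝓝 0) ↔ Tendsto x l (𝓝 y) := by
  have h1 : ∀ k, ‖x k - y‖ₑ ^ 2 = ENNReal.ofReal (‖x k - y‖ ^ 2) := fun k => by
    rw [ENNReal.ofReal_pow (norm_nonneg _), ofReal_norm]
  rw [tendsto_iff_norm_sub_tendsto_zero]
  simp_rw [h1]
  constructor
  · intro h
    have h2 := (ENNReal.tendsto_toReal ENNReal.zero_ne_top).comp h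
    simpa [Function.comp_def] using h2.sqrt
  · intro h
    simpa using ENNReal.tendsto_ofReal (h.pow 2)

omit [CompleteSpace U] in
-- The two lower integrals in the definition are squared `L²` distances, so the definition describes
-- sequential limits of elementary pairs, that is, the closure of their span. Uniqueness of `Y` then
-- follows from the isometry.
lemma hasItoIntegral_iff {φ : Set.Icc (0 : ℝ) T → Lp U 2 P} {Y : Lp ℝ 2 P}
    {v : Lp (Lp U 2 P) 2 (timeMeasure T)} (hv : v =ᵐ[timeMeasure T] φ) :
    HasItoIntegral ℱ P W φ Y ↔ (v, Y) ∈ itoGraph ℱ W := by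
  have key1 : ∀ f : ElementaryProcess ℱ U,
      ∫⁻ s, ∫⁻ ω, ‖f.val s ω - φ s ω‖ₑ ^ 2 ∂P ∂(timeMeasure T) = ‖f.toLp P - v‖ₑ ^ 2 := fun f => by
    rw [← lintegral_enorm_sq_Lp]
    refine lintegral_congr_ae ?_
    filter_upwards [f.toLp_ae_eq (P := P), hv, Lp.coeFn_sub (f.toLp P) v] with s h1 h2 h3
    rw [h3, Pi.sub_apply, h2, ← lintegral_enorm_sq_Lp]
    refine lintegral_congr_ae ?_
    filter_upwards [h1, Lp.coeFn_sub (f.toLp P s) (φ s)] with ω h4 h5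
    rw [h5, Pi.sub_apply, h4]
  have key2 : ∀ f : ElementaryProcess ℱ U,
      ∫⁻ ω, ‖f.integral W ω - Y ω‖ₑ ^ 2 ∂P = ‖f.integralLp W - Y‖ₑ ^ 2 := fun f => by
    rw [← lintegral_enorm_sq_Lp]
    refine lintegral_congr_ae ?_
    filter_upwards [f.integral_ae_eq (W := W), Lp.coeFn_sub (f.integralLp W) Y] with ω h4 h5
    rw [h5, Pi.sub_apply, h4]
  simp only [HasItoIntegral, key1, key2, tendsto_enorm_sub_sq_iff]
  rw [itoGraph, ← SetLike.mem_coe, Submodule.topologicalClosure_coe,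
    mem_closure_iff_seq_limit]
  constructor
  · rintro ⟨-, f, h1, h2⟩
    exact ⟨_, fun k => (f k).mem_span, h1.prodMk_nhds h2⟩
  · rintro ⟨x, hx, hlim⟩
    choose f hf using fun k => ElementaryProcess.exists_of_mem_span (hx k)
    obtain rfl : (fun k => ((f k).toLp P, (f k).integralLp W)) = x := funext hf
    exact ⟨(Lp.aestronglyMeasurable v).congr hv, f, hlim.fst_nhds, hlim.snd_nhds⟩

end Ito

/-! ### Curves cut off at time `t` and their step approximations. -/

section Cutoff

variable {T : ℝ} {B : Type*} [NormedAddCommGroup B]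

instance nullSingletonClass_timeMeasure : NullSingletonClass (timeMeasure T) where
  measure_singleton x := by
    rw [timeMeasure, comap_subtype_coe_apply measurableSet_Icc, Set.image_singleton]
    exact measure_singleton _

lemma memLp_indicator_Iic (t : Set.Icc (0 : ℝ) T) (ψ : C(Set.Icc (0 : ℝ) T, B)) :
    MemLp ((Set.Iic t).indicator ψ) 2 (timeMeasure T) :=
  (MemLp.of_bound ψ.continuous.aestronglyMeasurable ‖ψ‖
    (ae_of_all _ ψ.norm_coe_le_norm)).indicator measurableSet_Iic

lemma Lp_norm_le_of_bound {f : Lp B 2 (timeMeasure T)} {C : ℝ} (hC : 0 ≤ C)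
    (hf : ∀ᵐ s ∂(timeMeasure T), ‖f s‖ ≤ C) :
    ‖f‖ ≤ (measureUnivNNReal (timeMeasure T) : ℝ) ^ (2 : ℝ≥0∞).toReal⁻¹ * C :=
  Lp.norm_le_of_ae_bound hC hf

variable [NormedSpace ℝ B]

/-- The square integrable curve `s ↦ 1_{s ≤ t} ψ s`. -/
noncomputable def cutoffL (t : Set.Icc (0 : ℝ) T) :
    C(Set.Icc (0 : ℝ) T, B) →L[ℝ] Lp B 2 (timeMeasure T) :=
  LinearMap.mkContinuous
    { toFun := fun ψ => (memLp_indicator_Iic t ψ).toLp _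
      map_add' := fun ψ χ => by
        rw [← MemLp.toLp_add]
        congr 1
        exact Set.indicator_add _ _ _
      map_smul' := fun c ψ => by
        rw [RingHom.id_apply, ← MemLp.toLp_const_smul]
        congr 1
        exact Set.indicator_const_smul (Set.Iic t) c ψ }
    ((measureUnivNNReal (timeMeasure T) : ℝ) ^ (2 : ℝ≥0∞).toReal⁻¹)
    fun ψ => by
      refine Lp_norm_le_of_bound (norm_nonneg _) ?_
      filter_upwards [(memLp_indicator_Iic t ψ).coeFn_toLp] with s hs
      exact (congrArg norm hs).trans_le
        ((norm_indicator_le_norm_self _ _).trans (ψ.norm_coe_le_norm s))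

lemma cutoffL_coeFn (t : Set.Icc (0 : ℝ) T) (ψ : C(Set.Icc (0 : ℝ) T, B)) :
    cutoffL t ψ =ᵐ[timeMeasure T] (Set.Iic t).indicator ψ :=
  (memLp_indicator_Iic t ψ).coeFn_toLp

lemma norm_cutoffL_le (t : Set.Icc (0 : ℝ) T) :
    ‖(cutoffL t : C(Set.Icc (0 : ℝ) T, B) →L[ℝ] _)‖ ≤
      (measureUnivNNReal (timeMeasure T) : ℝ) ^ (2 : ℝ≥0∞).toReal⁻¹ :=
  LinearMap.mkContinuous_norm_le _ (by positivity) _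

/-- Dominated convergence: the cutoffs converge at every `s ≠ t₀`, and a single time is a null set.
-/
lemma continuous_cutoffL_apply (ψ : C(Set.Icc (0 : ℝ) T, B)) :
    Continuous fun t => cutoffL t ψ := by
  refine continuous_iff_continuousAt.2 fun t₀ => tendsto_enorm_sub_sq_iff.1 ?_
  have h1 : ∀ t, ‖cutoffL t ψ - cutoffL t₀ ψ‖ₑ ^ 2 = ∫⁻ s, ‖(Set.Iic t).indicator ψ s -
      (Set.Iic t₀).indicator ψ s‖ₑ ^ 2 ∂(timeMeasure T) := fun t => by
    rw [← lintegral_enorm_sq_Lp]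
    refine lintegral_congr_ae ?_
    filter_upwards [Lp.coeFn_sub (cutoffL t ψ) (cutoffL t₀ ψ), cutoffL_coeFn t ψ,
      cutoffL_coeFn t₀ ψ] with s h1 h2 h3
    rw [h1, Pi.sub_apply, h2, h3]
  simp_rw [h1]
  rw [← lintegral_zero (μ := timeMeasure T)]
  refine tendsto_lintegral_filter_of_dominated_convergence
    (fun _ => ENNReal.ofReal (2 * ‖ψ‖) ^ 2) ?_ ?_ ?_ ?_
  · refine Eventually.of_forall fun t => ?_
    have h2 : ∀ r : Set.Icc (0 : ℝ) T,
        StronglyMeasurable ((Set.Iic r).indicator ψ) := fun r =>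
      ψ.continuous.stronglyMeasurable.indicator measurableSet_Iic
    exact ((h2 t).sub (h2 t₀)).enorm.pow_const 2
  · refine Eventually.of_forall fun t => ae_of_all _ fun s => ?_
    rw [← ofReal_norm]
    gcongr
    refine (norm_sub_le _ _).trans ?_
    rw [two_mul]
    exact add_le_add ((norm_indicator_le_norm_self _ _).trans (ψ.norm_coe_le_norm s))
      ((norm_indicator_le_norm_self _ _).trans (ψ.norm_coe_le_norm s))
  · rw [lintegral_const]
    exact ENNReal.mul_ne_top (ENNReal.pow_ne_top ENNReal.ofReal_ne_top) (measure_ne_top _ _)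
  · have h3 : ∀ᵐ s ∂(timeMeasure T), s ≠ t₀ := by
      rw [ae_iff]
      simp
    filter_upwards [h3] with s hs
    refine tendsto_const_nhds.congr' ?_
    rcases lt_or_gt_of_ne hs with h | h
    · filter_upwards [lt_mem_nhds h] with t ht
      rw [Set.indicator_of_mem (show s ∈ Set.Iic t from le_of_lt ht),
        Set.indicator_of_mem (show s ∈ Set.Iic t₀ from h.le)]
      simp
    · filter_upwards [gt_mem_nhds h] with t ht
      rw [Set.indicator_of_notMem (show s ∉ Set.Iic t from not_le.2 ht),
        Set.indicator_of_notMem (show s ∉ Set.Iic t₀ from not_le.2 h)]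
      simp

lemma continuous_cutoffL_comp {ψ : Set.Icc (0 : ℝ) T → C(Set.Icc (0 : ℝ) T, B)}
    (hψ : Continuous ψ) : Continuous fun t => cutoffL t (ψ t) := by
  refine continuous_iff_continuousAt.2 fun t₀ => ?_
  rw [ContinuousAt, tendsto_iff_norm_sub_tendsto_zero]
  have h1 := (tendsto_iff_norm_sub_tendsto_zero.1 (hψ.tendsto t₀)).const_mul
    ((measureUnivNNReal (timeMeasure T) : ℝ) ^ (2 : ℝ≥0∞).toReal⁻¹)
  have h2 := tendsto_iff_norm_sub_tendsto_zero.1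
    ((continuous_cutoffL_apply (ψ t₀)).tendsto t₀)
  have h3 := h1.add h2
  rw [mul_zero, zero_add] at h3
  refine squeeze_zero (fun _ => norm_nonneg _) (fun t => ?_) h3
  have h4 : cutoffL t (ψ t) - cutoffL t₀ (ψ t₀) =
      cutoffL t (ψ t - ψ t₀) + (cutoffL t (ψ t₀) - cutoffL t₀ (ψ t₀)) := by
    rw [map_sub]; abel
  rw [h4]
  exact (norm_add_le _ _).trans (add_le_add_left
    (ContinuousLinearMap.le_of_opNorm_le _ (norm_cutoffL_le t) _) _)

/-- By uniform continuity, `ψ` is approximated on each cell of a fine partition by its value at the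
left endpoint. The left endpoint is what makes the approximation predictable when `ψ` is adapted. -/
lemma exists_step_approx (hT : 0 ≤ T) {N : Submodule ℝ (Lp B 2 (timeMeasure T))}
    {t : Set.Icc (0 : ℝ) T} {ψ : C(Set.Icc (0 : ℝ) T, B)}
    (h : ∀ a b : Set.Icc (0 : ℝ) T, a ≤ b → b ≤ t →
      indicatorConstLp 2 (measurableSet_Ioc : MeasurableSet (Set.Ioc a b))
        (measure_ne_top _ _) (ψ a) ∈ N) {ε : ℝ} (hε : 0 < ε) :
    ∃ v ∈ N, ∀ᵐ s ∂(timeMeasure T), ‖v s - (Set.Iic t).indicator ψ s‖ ≤ ε := by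
  obtain ⟨δ, hδ, hψ⟩ := Metric.uniformContinuous_iff.1
    (CompactSpace.uniformContinuous_of_continuous ψ.continuous) ε hε
  let o : Set.Icc (0 : ℝ) T := ⟨0, Set.left_mem_Icc.2 hT⟩
  have ho : ∀ s : Set.Icc (0 : ℝ) T, o ≤ s := fun s => s.2.1
  -- The partition points stop at `t`. The mesh is `δ / 2`, since cells contain their right
  -- endpoints and distances strictly below `δ` are required.
  let p : ℕ → Set.Icc (0 : ℝ) T := fun n =>
    ⟨min (n * (δ / 2)) t, le_min (by positivity) t.2.1, (min_le_right _ _).trans t.2.2⟩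
  have hpt : ∀ n, p n ≤ t := fun n => min_le_right (n * (δ / 2)) (t : ℝ)
  have hmono : ∀ n, p n ≤ p (n + 1) := fun n =>
    min_le_min_right (t : ℝ) (by push_cast; nlinarith)
  have hstep : ∀ n s, s ∈ Set.Ioc (p n) (p (n + 1)) → dist s (p n) < δ := by
    rintro n s ⟨h1, h2⟩
    have h1' : min (n * (δ / 2)) (t : ℝ) < s := h1
    have h2' : (s : ℝ) ≤ min ((n + 1 : ℕ) * (δ / 2)) (t : ℝ) := h2
    have h3 : dist s (p n) = (s : ℝ) - min (n * (δ / 2)) (t : ℝ) := by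
      rw [Subtype.dist_eq, Real.dist_eq, abs_of_pos]
      exact sub_pos.2 h1'
    rw [h3]
    push_cast at h2'
    rcases le_total (n * (δ / 2)) (t : ℝ) with h4 | h4
    · rw [min_eq_left h4]
      have := h2'.trans (min_le_left _ _)
      linarith
    · rw [min_eq_right h4] at h1' ⊢
      have := h2'.trans (min_le_right _ _)
      linarith
  -- The error bound is zero off `(0, p n]`, so `v` vanishes on the next cell and a new step can
  -- simply be added.
  have key : ∀ n, ∃ v ∈ N, ∀ᵐ s ∂(timeMeasure T),
      ‖v s - (Set.Ioc o (p n)).indicator ψ s‖ ≤ (Set.Ioc o (p n)).indicator (fun _ => ε) s := by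
    intro n
    induction n with
    | zero =>
      refine ⟨0, N.zero_mem, ?_⟩
      have hp0 : p 0 = o := Subtype.ext (by simp [p, o, t.2.1])
      filter_upwards [Lp.coeFn_zero B 2 (timeMeasure T)] with s hs
      rw [hs, hp0]
      simp
    | succ n ih =>
      obtain ⟨v, hv, hvs⟩ := ih
      refine ⟨_, N.add_mem hv (h (p n) (p (n + 1)) (hmono n) (hpt _)), ?_⟩
      filter_upwards [hvs, Lp.coeFn_add v (indicatorConstLp 2 (measurableSet_Ioc :
        MeasurableSet (Set.Ioc (p n) (p (n + 1)))) (measure_ne_top _ _) (ψ (p n))),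
        indicatorConstLp_coeFn (p := 2) (hs := (measurableSet_Ioc :
          MeasurableSet (Set.Ioc (p n) (p (n + 1))))) (hμs := measure_ne_top (timeMeasure T) _)
          (c := ψ (p n))] with s h1 h2 h3
      rw [h2, Pi.add_apply, h3]
      by_cases hs1 : s ∈ Set.Ioc (p n) (p (n + 1))
      · have hs2 : s ∉ Set.Ioc o (p n) := fun hs => not_le.2 hs1.1 hs.2
        have hs3 : s ∈ Set.Ioc o (p (n + 1)) := ⟨(ho _).trans_lt hs1.1, hs1.2⟩
        rw [Set.indicator_of_notMem hs2, Set.indicator_of_notMem hs2, sub_zero] at h1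
        rw [norm_le_zero_iff.1 h1, zero_add, Set.indicator_of_mem hs1, Set.indicator_of_mem hs3,
          Set.indicator_of_mem hs3, ← dist_eq_norm, dist_comm]
        exact (hψ (hstep n s hs1)).le
      · have hs2 : s ∈ Set.Ioc o (p (n + 1)) ↔ s ∈ Set.Ioc o (p n) := by
          constructor
          · intro hs
            exact ⟨hs.1, not_lt.1 fun hlt => hs1 ⟨hlt, hs.2⟩⟩
          · exact fun hs => ⟨hs.1, hs.2.trans (hmono n)⟩
        rw [Set.indicator_of_notMem hs1, add_zero]
        rwa [Set.indicator_eq_indicator hs2 rfl, Set.indicator_eq_indicator hs2 rfl]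
  obtain ⟨n, hn⟩ := exists_nat_ge (t / (δ / 2))
  have hpn : p n = t := Subtype.ext (min_eq_right (by rwa [div_le_iff₀ (by positivity)] at hn))
  obtain ⟨v, hv, hvs⟩ := key n
  rw [hpn] at hvs
  refine ⟨v, hv, ?_⟩
  have h3 : ∀ᵐ s ∂(timeMeasure T), s ≠ o := by
    rw [ae_iff]
    simp
  filter_upwards [hvs, h3] with s hs hso
  have h4 : s ∈ Set.Ioc o t ↔ s ∈ Set.Iic t :=
    ⟨fun h => h.2, fun h => ⟨lt_of_le_of_ne (ho s) hso.symm, h⟩⟩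
  have h5 : (Set.Ioc o t).indicator ψ s = (Set.Iic t).indicator ψ s :=
    Set.indicator_eq_indicator h4 rfl
  rw [h5] at hs
  exact hs.trans (Set.indicator_apply_le' (fun _ => le_rfl) fun _ => hε.le)

lemma cutoffL_mem (hT : 0 ≤ T) {N : Submodule ℝ (Lp B 2 (timeMeasure T))}
    (hN : IsClosed (N : Set (Lp B 2 (timeMeasure T))))
    {t : Set.Icc (0 : ℝ) T} {ψ : C(Set.Icc (0 : ℝ) T, B)}
    (h : ∀ a b : Set.Icc (0 : ℝ) T, a ≤ b → b ≤ t →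
      indicatorConstLp 2 (measurableSet_Ioc : MeasurableSet (Set.Ioc a b))
        (measure_ne_top _ _) (ψ a) ∈ N) : cutoffL t ψ ∈ N := by
  rw [← SetLike.mem_coe, ← hN.closure_eq, Metric.mem_closure_iff]
  intro ε hε
  set C : ℝ := (measureUnivNNReal (timeMeasure T) : ℝ) ^ (2 : ℝ≥0∞).toReal⁻¹ with hC
  have hC0 : 0 ≤ C := by positivity
  obtain ⟨v, hv, hvs⟩ := exists_step_approx hT h (ε := ε / (C + 1)) (by positivity)
  refine ⟨v, hv, ?_⟩
  rw [dist_comm, dist_eq_norm]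
  refine (Lp_norm_le_of_bound (C := ε / (C + 1)) (by positivity) ?_).trans_lt ?_
  · filter_upwards [hvs, Lp.coeFn_sub v (cutoffL t ψ), cutoffL_coeFn t ψ] with s h1 h2 h3
    rwa [h2, Pi.sub_apply, h3]
  · rw [← hC, mul_div_assoc', div_lt_iff₀ (by positivity)]
    nlinarith

/-- The source of smallness in the contraction: `∫_0^t c² exp (2 α s) ds = c² (exp (2 α t) - 1) / (2
α)`, where the `-1` is dropped. -/
lemma norm_cutoffL_le_exp (t : Set.Icc (0 : ℝ) T) {ψ : C(Set.Icc (0 : ℝ) T, B)} {c α : ℝ}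
    (hc : 0 ≤ c) (hα : 0 < α) (hψ : ∀ s ≤ t, ‖ψ s‖ ≤ c * Real.exp (α * s)) :
    ‖cutoffL t ψ‖ ≤ c * Real.exp (α * t) / √(2 * α) := by
  let χ : C(Set.Icc (0 : ℝ) T, ℝ) := ⟨fun s => c * Real.exp (α * s), by fun_prop⟩
  have h1 : ‖cutoffL t ψ‖ ≤ ‖cutoffL t χ‖ := by
    refine Lp.norm_le_norm_of_ae_le ?_
    filter_upwards [cutoffL_coeFn t ψ, cutoffL_coeFn t χ] with s h1 h2
    rw [h1, h2]
    by_cases hs : s ∈ Set.Iic t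
    · rw [Set.indicator_of_mem hs, Set.indicator_of_mem hs]
      exact (hψ s hs).trans (le_abs_self _)
    · rw [Set.indicator_of_notMem hs, norm_zero]
      exact norm_nonneg _
  have h2 : ‖cutoffL t χ‖ ^ 2 = ∫ s in (0 : ℝ)..t, c ^ 2 * Real.exp (2 * α * s) := by
    rw [← real_inner_self_eq_norm_sq, L2.inner_def, intervalIntegral.integral_of_le t.2.1,
      ← integral_Icc_eq_integral_Ioc, ← integral_indicator measurableSet_Icc]
    have h3 : (∫ s, (Set.Icc (0 : ℝ) t).indicator (fun s => c ^ 2 * Real.exp (2 * α * s)) s) =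
        ∫ s in Set.Icc (0 : ℝ) T,
          (Set.Icc (0 : ℝ) t).indicator (fun s => c ^ 2 * Real.exp (2 * α * s)) s := by
      rw [← integral_indicator measurableSet_Icc, Set.indicator_indicator,
        Set.inter_eq_self_of_subset_right (Set.Icc_subset_Icc_right t.2.2)]
    rw [h3, ← integral_subtype_comap measurableSet_Icc]
    refine integral_congr_ae ?_
    filter_upwards [cutoffL_coeFn t χ] with s hs
    rw [hs]
    by_cases hst : s ≤ t
    · have h4 : (s : ℝ) ∈ Set.Icc (0 : ℝ) t := ⟨s.2.1, hst⟩
      rw [Set.indicator_of_mem (show s ∈ Set.Iic t from hst), Set.indicator_of_mem h4]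
      change (c * Real.exp (α * s)) * (c * Real.exp (α * s)) = _
      rw [show 2 * α * (s : ℝ) = α * s + α * s by ring, Real.exp_add]
      ring
    · have h4 : (s : ℝ) ∉ Set.Icc (0 : ℝ) t := fun h => hst h.2
      rw [Set.indicator_of_notMem (show s ∉ Set.Iic t from hst), Set.indicator_of_notMem h4]
      simp
  have h5 : ∫ s in (0 : ℝ)..t, c ^ 2 * Real.exp (2 * α * s) =
      c ^ 2 * ((Real.exp (2 * α * t) - 1) / (2 * α)) := by
    rw [intervalIntegral.integral_const_mul, intervalIntegral.integral_comp_mul_left _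
      (by positivity), integral_exp]
    rw [mul_zero, Real.exp_zero, smul_eq_mul]
    ring
  refine h1.trans ((sq_le_sq₀ (norm_nonneg _) (by positivity)).1 ?_)
  rw [h2, h5, div_pow, Real.sq_sqrt (by positivity), mul_pow, ← Real.exp_nat_mul, ← mul_div_assoc]
  gcongr
  rw [show ((2 : ℕ) : ℝ) * (α * t) = 2 * α * t by push_cast; ring]
  linarith

end Cutoff

/-! ### Adapted curves as limits of elementary ones. -/

section Adapted

variable {T : ℝ} {Ω K : Type*} {mΩ : MeasurableSpace Ω} [NormedAddCommGroup K]
  [NormedSpace ℝ K] {ℱ : Filtration (Set.Icc (0 : ℝ) T) mΩ} {P : Measure Ω}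
  [IsProbabilityMeasure P]

/-- `ℱ a`-measurable simple functions are dense among the `ℱ a`-measurable elements of `L²`, and `N`
is a closed subspace. -/
lemma indicatorConstLp_mem_of_elementaryCurve {N : Submodule ℝ (Lp (Lp K 2 P) 2 (timeMeasure T))}
    (hN : IsClosed (N : Set (Lp (Lp K 2 P) 2 (timeMeasure T)))) {a b : Set.Icc (0 : ℝ) T}
    (h : ∀ (A : Set Ω) (hA : MeasurableSet[ℱ a] A) (u : K),
      elementaryCurve a b (ℱ.le a _ hA) u ∈ N) {ξ : Lp K 2 P} (hξ : ξ ∈ lpMeas K ℝ (ℱ a) 2 P) :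
    indicatorConstLp 2 (measurableSet_Ioc : MeasurableSet (Set.Ioc a b))
      (measure_ne_top _ _) ξ ∈ N := by
  refine Lp.induction_stronglyMeasurable (ℱ.le a) (by simp)
    (fun ξ => indicatorConstLp 2 (measurableSet_Ioc : MeasurableSet (Set.Ioc a b))
      (measure_ne_top (timeMeasure T) _) ξ ∈ N) ?_ ?_ ?_ ξ
      (mem_lpMeas_iff_aestronglyMeasurable.1 hξ)
  · intro c s hs hμs
    exact h s hs c
  · intro f g hf hg _ _ _ h1 h2
    rw [← indicatorConstLp_add]
    exact N.add_mem h1 h2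
  · exact hN.preimage ((indicatorConstL (μ := timeMeasure T) (measurableSet_Ioc :
      MeasurableSet (Set.Ioc a b))).continuous.comp continuous_subtype_val)

/-- Used for two choices of `N`: the domain of the Itô integral, and the preimage under an integral
operator of the `ℱ t`-measurable variables. The second gives adaptedness of convolutions. -/
lemma cutoffL_mem_of_adapted (hT : 0 ≤ T) {N : Submodule ℝ (Lp (Lp K 2 P) 2 (timeMeasure T))}
    (hN : IsClosed (N : Set (Lp (Lp K 2 P) 2 (timeMeasure T)))) {t : Set.Icc (0 : ℝ) T}
    (h : ∀ (a b : Set.Icc (0 : ℝ) T), a ≤ b → b ≤ t → ∀ (A : Set Ω) (hA : MeasurableSet[ℱ a] A)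
      (u : K), elementaryCurve a b (ℱ.le a _ hA) u ∈ N)
    {ψ : C(Set.Icc (0 : ℝ) T, Lp K 2 P)} (hψ : ∀ s, ψ s ∈ lpMeas K ℝ (ℱ s) 2 P) :
    cutoffL t ψ ∈ N :=
  cutoffL_mem hT hN fun a b hab hbt =>
    indicatorConstLp_mem_of_elementaryCurve hN (h a b hab hbt) (hψ a)

end Adapted

/-! ### Cylindrical processes and non-anticipating coefficients. -/

section CylindricalProcesses

variable {T : ℝ} {Ω : Type*} {mΩ : MeasurableSpace Ω} {ℱ : Filtration (Set.Icc (0 : ℝ) T) mΩ}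
  {P : Measure Ω} {E : Type*} [NormedAddCommGroup E] [NormedSpace ℝ E]
  {K : Type*} [NormedAddCommGroup K] [NormedSpace ℝ K]

variable (ℱ P K) in
/-- The inclusion of adapted curves into all continuous curves. -/
noncomputable def adaptedInclusion : AdaptedCurve ℱ P K →L[ℝ] C(Set.Icc (0 : ℝ) T, Lp K 2 P) :=
  (adaptedCurves ℱ P K).subtypeL

instance completeSpace_adaptedCurve [CompleteSpace K] : CompleteSpace (AdaptedCurve ℱ P K) := by
  have h : IsClosed (adaptedCurves ℱ P K : Set C(Set.Icc (0 : ℝ) T, Lp K 2 P)) := by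
    have : (adaptedCurves ℱ P K : Set C(Set.Icc (0 : ℝ) T, Lp K 2 P)) =
        ⋂ t, (fun X => X t) ⁻¹' (lpMeas K ℝ (ℱ t) 2 P : Set (Lp K 2 P)) := by
      ext X
      simp only [Set.mem_iInter]
      rfl
    rw [this]
    refine isClosed_iInter fun t => IsClosed.preimage (continuous_eval_const t) ?_
    exact isClosed_aestronglyMeasurable (ℱ.le t)
  exact h.completeSpace_coe

namespace CylindricalProcess

lemma norm_eval_le (X : CylindricalProcess ℱ P E K) (t : Set.Icc (0 : ℝ) T) (e : E) :
    ‖X.eval t e‖ ≤ ‖X‖ * ‖e‖ :=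
  (ContinuousMap.norm_coe_le_norm (X e).1 t).trans (X.le_opNorm e)

lemma norm_le_of_eval {X : CylindricalProcess ℱ P E K} {C : ℝ} (hC : 0 ≤ C)
    (h : ∀ t e, ‖X.eval t e‖ ≤ C * ‖e‖) : ‖X‖ ≤ C :=
  X.opNorm_le_bound hC fun e =>
    (ContinuousMap.norm_le _ (by positivity)).2 fun t => h t e

@[ext]
lemma ext_eval {X Y : CylindricalProcess ℱ P E K} (h : ∀ t e, X.eval t e = Y.eval t e) :
    X = Y :=
  ContinuousLinearMap.ext fun e => Subtype.ext (ContinuousMap.ext fun t => h t e)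

lemma eval_sub (X Y : CylindricalProcess ℱ P E K) (t : Set.Icc (0 : ℝ) T) (e : E) :
    (X - Y).eval t e = X.eval t e - Y.eval t e := rfl

lemma eval_add (X Y : CylindricalProcess ℱ P E K) (t : Set.Icc (0 : ℝ) T) (e : E) :
    (X + Y).eval t e = X.eval t e + Y.eval t e := rfl

lemma eval_mem (X : CylindricalProcess ℱ P E K) (t : Set.Icc (0 : ℝ) T) (e : E) :
    X.eval t e ∈ lpMeas K ℝ (ℱ t) 2 P := (X e).2 t

/-- A cylindrical process from a bounded family of linear maps. -/
noncomputable def ofLinear (Y : Set.Icc (0 : ℝ) T → E →ₗ[ℝ] Lp K 2 P) (C : ℝ) (hC : 0 ≤ C)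
    (hbound : ∀ t e, ‖Y t e‖ ≤ C * ‖e‖) (hcont : ∀ e, Continuous fun t => Y t e)
    (hmeas : ∀ t e, Y t e ∈ lpMeas K ℝ (ℱ t) 2 P) : CylindricalProcess ℱ P E K :=
  LinearMap.mkContinuous (F := AdaptedCurve ℱ P K)
    { toFun := fun e => ⟨⟨fun t => Y t e, hcont e⟩, fun t => hmeas t e⟩
      map_add' := fun e e' => Subtype.ext (ContinuousMap.ext fun t => map_add (Y t) e e')
      map_smul' := fun c e => Subtype.ext (ContinuousMap.ext fun t => map_smul (Y t) c e) }
    C fun e => (ContinuousMap.norm_le _ (by positivity)).2 fun t => hbound t e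

lemma lpMeas_mono {s t : Set.Icc (0 : ℝ) T} (hst : s ≤ t) {ξ : Lp K 2 P}
    (hξ : ξ ∈ lpMeas K ℝ (ℱ s) 2 P) : ξ ∈ lpMeas K ℝ (ℱ t) 2 P := by
  rw [mem_lpMeas_iff_aestronglyMeasurable] at hξ ⊢
  exact hξ.mono (ℱ.mono hst)

/-- The process `X` stopped at time `t`. -/
noncomputable def stopped (X : CylindricalProcess ℱ P E K) (t : Set.Icc (0 : ℝ) T) :
    CylindricalProcess ℱ P E K :=
  ofLinear
    (fun s =>
      { toFun := fun e => X.eval (min s t) e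
        map_add' := fun e e' => by simp only [eval, map_add]; rfl
        map_smul' := fun c e => by simp only [eval, map_smul]; rfl })
    ‖X‖ (norm_nonneg _) (fun s e => X.norm_eval_le _ e)
    (fun e => (X e).1.continuous.comp (continuous_id.min continuous_const))
    fun s e => lpMeas_mono (min_le_left s t) (X.eval_mem _ e)

lemma stopped_eval (X : CylindricalProcess ℱ P E K) (s t : Set.Icc (0 : ℝ) T) (e : E) :
    (X.stopped t).eval s e = X.eval (min s t) e := rfl

end CylindricalProcess

open CylindricalProcess

/-- A Lipschitz non-anticipating coefficient preserves exponentially weighted bounds. -/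
lemma IsNonAnticipating.norm_eval_sub_le {H : Type*} [NormedAddCommGroup H] [NormedSpace ℝ H]
    {Φ : CylindricalProcess ℱ P E H → CylindricalProcess ℱ P E K} (hΦ : IsNonAnticipating Φ)
    {L : ℝ≥0} (hL : LipschitzWith L Φ) {X Y : CylindricalProcess ℱ P E H} {k α : ℝ} (hk : 0 ≤ k)
    (hα : 0 ≤ α) (h : ∀ s e, ‖X.eval s e - Y.eval s e‖ ≤ k * Real.exp (α * s) * ‖e‖)
    (s : Set.Icc (0 : ℝ) T) (e : E) :
    ‖(Φ X).eval s e - (Φ Y).eval s e‖ ≤ L * k * Real.exp (α * s) * ‖e‖ := by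
  -- Stopping at `s` does not change the value of the coefficient at `s`, but turns the bound up to
  -- time `s` into a bound in operator norm.
  have h1 : ∀ Z : CylindricalProcess ℱ P E H, (Φ Z).eval s e = (Φ (Z.stopped s)).eval s e := fun Z =>
    hΦ s Z (Z.stopped s) (fun r hr e => by rw [stopped_eval, min_eq_left hr]) s le_rfl e
  have h2 : ‖X.stopped s - Y.stopped s‖ ≤ k * Real.exp (α * s) := by
    refine norm_le_of_eval (by positivity) fun r e => ?_
    rw [eval_sub, stopped_eval, stopped_eval]
    refine (h _ e).trans ?_
    gcongr
    exact min_le_right r s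
  rw [h1 X, h1 Y, ← eval_sub]
  refine (norm_eval_le _ _ _).trans ?_
  gcongr
  refine (hL.norm_sub_le _ _).trans ?_
  rw [mul_assoc]
  gcongr

/-! ### Convolutions with the semigroup. -/

namespace IsStronglyContinuousSemigroup

variable {S : ℝ≥0 → E →L[ℝ] E}

/-- Orbits are bounded on compact time intervals, so the uniform boundedness principle applies.
Negative `r` are covered because `toNNReal` sends them to `0`; this handles `t - s` with `s > t`. -/
lemma exists_bound [CompleteSpace E] (hS : IsStronglyContinuousSemigroup S) (T : ℝ) :
    ∃ M : ℝ, 0 ≤ M ∧ ∀ r : ℝ, r ≤ T → ‖S r.toNNReal‖ ≤ M := by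
  have h1 : ∀ e, ∃ C, ∀ i : Set.Icc (0 : ℝ≥0) T.toNNReal, ‖S i e‖ ≤ C := fun e => by
    obtain ⟨C, hC⟩ := (isCompact_Icc (a := (0 : ℝ≥0)) (b := T.toNNReal)).exists_bound_of_continuousOn
      (hS.continuous e).continuousOn
    exact ⟨C, fun i => hC i i.2⟩
  obtain ⟨C, hC⟩ := banach_steinhaus h1
  exact ⟨max C 0, le_max_right _ _, fun r hr => (hC ⟨r.toNNReal, zero_le,
    Real.toNNReal_le_toNNReal hr⟩).trans (le_max_left _ _)⟩

/-- The curve `s ↦ Z_s(S_{t - s} e)`. -/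
noncomputable def mildCurve (hS : IsStronglyContinuousSemigroup S)
    (Z : CylindricalProcess ℱ P E K) (e : E) :
    C(Set.Icc (0 : ℝ) T, C(Set.Icc (0 : ℝ) T, Lp K 2 P)) :=
  -- Truncating `t - s` at `0` extends the curve continuously beyond `s = t`, and joint continuity
  -- in `(t, s)` yields, by currying, continuity in `t` for the supremum norm.
  ContinuousMap.curry ⟨fun p => Z.eval p.2 (S (Real.toNNReal (p.1 - p.2)) e), by
    have h1 : Continuous fun p : Set.Icc (0 : ℝ) T × Set.Icc (0 : ℝ) T =>
        adaptedInclusion ℱ P K (Z (S (Real.toNNReal (p.1 - p.2)) e)) :=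
      (adaptedInclusion ℱ P K).continuous.comp (Z.continuous.comp ((hS.continuous e).comp
        (continuous_real_toNNReal.comp (by fun_prop))))
    exact h1.eval continuous_snd⟩

lemma mildCurve_apply (hS : IsStronglyContinuousSemigroup S)
    (Z : CylindricalProcess ℱ P E K) (e : E) (t s : Set.Icc (0 : ℝ) T) :
    hS.mildCurve Z e t s = Z.eval s (S (Real.toNNReal (t - s)) e) := rfl

lemma mildCurve_add (hS : IsStronglyContinuousSemigroup S)
    (Z : CylindricalProcess ℱ P E K) (e e' : E) (t : Set.Icc (0 : ℝ) T) :
    hS.mildCurve Z (e + e') t = hS.mildCurve Z e t + hS.mildCurve Z e' t :=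
  ContinuousMap.ext fun s => by
    simp only [mildCurve_apply, ContinuousMap.add_apply, map_add, eval]
    rfl

lemma mildCurve_smul (hS : IsStronglyContinuousSemigroup S)
    (Z : CylindricalProcess ℱ P E K) (c : ℝ) (e : E) (t : Set.Icc (0 : ℝ) T) :
    hS.mildCurve Z (c • e) t = c • hS.mildCurve Z e t :=
  ContinuousMap.ext fun s => by
    simp only [mildCurve_apply, ContinuousMap.smul_apply, map_smul, eval]
    rfl

lemma mildCurve_sub (hS : IsStronglyContinuousSemigroup S)
    (Z Z' : CylindricalProcess ℱ P E K) (e : E) (t : Set.Icc (0 : ℝ) T) :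
    hS.mildCurve (Z - Z') e t = hS.mildCurve Z e t - hS.mildCurve Z' e t := rfl

lemma mildCurve_mem (hS : IsStronglyContinuousSemigroup S)
    (Z : CylindricalProcess ℱ P E K) (e : E) (t s : Set.Icc (0 : ℝ) T) :
    hS.mildCurve Z e t s ∈ lpMeas K ℝ (ℱ s) 2 P := eval_mem _ _ _

lemma norm_mildCurve_le (hS : IsStronglyContinuousSemigroup S) {M : ℝ} (hM0 : 0 ≤ M)
    (hM : ∀ r : ℝ, r ≤ T → ‖S r.toNNReal‖ ≤ M)
    (Z : CylindricalProcess ℱ P E K) (e : E) (t : Set.Icc (0 : ℝ) T) :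
    ‖hS.mildCurve Z e t‖ ≤ ‖Z‖ * M * ‖e‖ := by
  refine (ContinuousMap.norm_le _ (by positivity)).2 fun s => ?_
  rw [mildCurve_apply, mul_assoc]
  refine (norm_eval_le _ _ _).trans ?_
  gcongr
  refine (S _).le_of_opNorm_le (hM _ ?_) e
  linarith [t.2.2, s.2.1]

lemma norm_cutoffL_mildCurve_le (hS : IsStronglyContinuousSemigroup S) {M : ℝ} (hM0 : 0 ≤ M)
    (hM : ∀ r : ℝ, r ≤ T → ‖S r.toNNReal‖ ≤ M) (Z : CylindricalProcess ℱ P E K) {k α : ℝ}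
    (hk : 0 ≤ k) (hα : 0 < α) (h : ∀ s e, ‖Z.eval s e‖ ≤ k * Real.exp (α * s) * ‖e‖)
    (t : Set.Icc (0 : ℝ) T) (e : E) :
    ‖cutoffL t (hS.mildCurve Z e t)‖ ≤ k * M * ‖e‖ * Real.exp (α * t) / √(2 * α) := by
  refine norm_cutoffL_le_exp t (by positivity) hα fun s _ => ?_
  rw [mildCurve_apply]
  refine (h _ _).trans ?_
  have h1 : ‖S (Real.toNNReal (t - s)) e‖ ≤ M * ‖e‖ :=
    (S _).le_of_opNorm_le (hM _ (by linarith [t.2.2, s.2.1])) e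
  calc k * Real.exp (α * s) * ‖S (Real.toNNReal (t - s)) e‖
      ≤ k * Real.exp (α * s) * (M * ‖e‖) := by gcongr
    _ = k * M * ‖e‖ * Real.exp (α * s) := by ring

/-- The convolution `t ↦ J(1_{s ≤ t} Z_s(S_{t - s} e))` of a process with the semigroup, for
an adapted integral operator `J`. -/
noncomputable def convolution [CompleteSpace E] [IsProbabilityMeasure P] (hT : 0 ≤ T)
    (hS : IsStronglyContinuousSemigroup S)
    (J : Lp (Lp K 2 P) 2 (timeMeasure T) →L[ℝ] Lp ℝ 2 P)
    (hJ : ∀ (a b t : Set.Icc (0 : ℝ) T), a ≤ b → b ≤ t → ∀ (A : Set Ω)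
      (hA : MeasurableSet[ℱ a] A) (u : K),
      J (elementaryCurve a b (ℱ.le a _ hA) u) ∈ lpMeas ℝ ℝ (ℱ t) 2 P)
    (Z : CylindricalProcess ℱ P E K) : CylindricalProcess ℱ P E ℝ :=
  ofLinear
    (fun t =>
      { toFun := fun e => J (cutoffL t (hS.mildCurve Z e t))
        map_add' := fun e e' => by rw [mildCurve_add, map_add, map_add]
        map_smul' := fun c e => by rw [mildCurve_smul, map_smul, map_smul, RingHom.id_apply] })
    (‖J‖ * ((measureUnivNNReal (timeMeasure T) : ℝ) ^ (2 : ℝ≥0∞).toReal⁻¹ *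
      (‖Z‖ * (hS.exists_bound T).choose)))
    (by have := (hS.exists_bound T).choose_spec.1; positivity)
    (fun t e => by
      have h0 := (hS.exists_bound T).choose_spec.1
      refine (J.le_opNorm _).trans ?_
      rw [mul_assoc ‖J‖, mul_assoc _ (‖Z‖ * _)]
      refine mul_le_mul_of_nonneg_left ?_ (norm_nonneg _)
      refine (ContinuousLinearMap.le_of_opNorm_le _ (norm_cutoffL_le t) _).trans ?_
      exact mul_le_mul_of_nonneg_left
        (hS.norm_mildCurve_le h0 (hS.exists_bound T).choose_spec.2 Z e t) (by positivity))
    (fun e => J.continuous.comp (continuous_cutoffL_comp (hS.mildCurve Z e).continuous))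
    fun t e => by
      -- Adaptedness: the curves that `J` sends to `ℱ t`-measurable variables form a closed subspace
      -- containing the elementary curves up to time `t`.
      have hcl : IsClosed ((lpMeas ℝ ℝ (ℱ t) 2 P).comap J.toLinearMap :
          Set (Lp (Lp K 2 P) 2 (timeMeasure T))) :=
        IsClosed.preimage J.continuous (isClosed_aestronglyMeasurable (ℱ.le t))
      exact cutoffL_mem_of_adapted hT hcl (fun a b hab hbt A hA u => hJ a b t hab hbt A hA u)
        (hS.mildCurve_mem Z e t)

lemma convolution_eval [CompleteSpace E] [IsProbabilityMeasure P] (hT : 0 ≤ T)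
    (hS : IsStronglyContinuousSemigroup S)
    (J : Lp (Lp K 2 P) 2 (timeMeasure T) →L[ℝ] Lp ℝ 2 P)
    (hJ : ∀ (a b t : Set.Icc (0 : ℝ) T), a ≤ b → b ≤ t → ∀ (A : Set Ω)
      (hA : MeasurableSet[ℱ a] A) (u : K),
      J (elementaryCurve a b (ℱ.le a _ hA) u) ∈ lpMeas ℝ ℝ (ℱ t) 2 P)
    (Z : CylindricalProcess ℱ P E K) (t : Set.Icc (0 : ℝ) T) (e : E) :
    (hS.convolution hT J hJ Z).eval t e = J (cutoffL t (hS.mildCurve Z e t)) := rfl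

lemma norm_convolution_sub_le [CompleteSpace E] [IsProbabilityMeasure P] (hT : 0 ≤ T)
    (hS : IsStronglyContinuousSemigroup S) {M : ℝ} (hM0 : 0 ≤ M)
    (hM : ∀ r : ℝ, r ≤ T → ‖S r.toNNReal‖ ≤ M)
    (J : Lp (Lp K 2 P) 2 (timeMeasure T) →L[ℝ] Lp ℝ 2 P)
    (hJ : ∀ (a b t : Set.Icc (0 : ℝ) T), a ≤ b → b ≤ t → ∀ (A : Set Ω)
      (hA : MeasurableSet[ℱ a] A) (u : K),
      J (elementaryCurve a b (ℱ.le a _ hA) u) ∈ lpMeas ℝ ℝ (ℱ t) 2 P)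
    (Z Z' : CylindricalProcess ℱ P E K) {k α : ℝ} (hk : 0 ≤ k) (hα : 0 < α)
    (h : ∀ s e, ‖Z.eval s e - Z'.eval s e‖ ≤ k * Real.exp (α * s) * ‖e‖)
    (t : Set.Icc (0 : ℝ) T) (e : E) :
    ‖(hS.convolution hT J hJ Z).eval t e - (hS.convolution hT J hJ Z').eval t e‖ ≤
      ‖J‖ * M / √(2 * α) * k * Real.exp (α * t) * ‖e‖ := by
  rw [convolution_eval, convolution_eval, ← map_sub, ← map_sub, ← mildCurve_sub]
  refine (J.le_opNorm _).trans ?_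
  calc _ ≤ ‖J‖ * (k * M * ‖e‖ * Real.exp (α * t) / √(2 * α)) :=
        mul_le_mul_of_nonneg_left (hS.norm_cutoffL_mildCurve_le hM0 hM (Z - Z') hk hα h t e)
          (norm_nonneg _)
    _ = _ := by ring

end IsStronglyContinuousSemigroup

/-- A map on cylindrical processes which contracts an exponentially weighted norm has a unique
fixed point. -/
lemma existsUnique_isFixedPt [CompleteSpace K] {Φ : CylindricalProcess ℱ P E K →
    CylindricalProcess ℱ P E K} {α : ℝ} (hα : 0 ≤ α)
    (hΦ : ∀ (X Y : CylindricalProcess ℱ P E K) (k : ℝ), 0 ≤ k →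
      (∀ s e, ‖X.eval s e - Y.eval s e‖ ≤ k * Real.exp (α * s) * ‖e‖) →
      ∀ s e, ‖(Φ X).eval s e - (Φ Y).eval s e‖ ≤ 1 / 2 * k * Real.exp (α * s) * ‖e‖) :
    ∃! X, Φ X = X := by
  have h1 : ∀ (n : ℕ) (X Y : CylindricalProcess ℱ P E K) (s : Set.Icc (0 : ℝ) T) (e : E),
      ‖(Φ^[n] X).eval s e - (Φ^[n] Y).eval s e‖ ≤
        (1 / 2) ^ n * ‖X - Y‖ * Real.exp (α * s) * ‖e‖ := by
    intro n
    induction n with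
    | zero =>
      intro X Y s e
      rw [pow_zero, one_mul, Function.iterate_zero, id, id, ← eval_sub]
      refine (norm_eval_le _ _ _).trans ?_
      gcongr
      exact le_mul_of_one_le_right (norm_nonneg _)
        (Real.one_le_exp (mul_nonneg hα s.2.1))
    | succ n ih =>
      intro X Y s e
      rw [Function.iterate_succ_apply', Function.iterate_succ_apply', pow_succ']
      have := hΦ _ _ _ (by positivity) (ih X Y) s e
      rwa [← mul_assoc (1 / 2 : ℝ)] at this
  have h2 : ∀ (n : ℕ) (X Y : CylindricalProcess ℱ P E K),
      ‖Φ^[n] X - Φ^[n] Y‖ ≤ (1 / 2) ^ n * Real.exp (α * T) * ‖X - Y‖ := fun n X Y =>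
    norm_le_of_eval (by positivity) fun s e => by
      rw [eval_sub]
      refine (h1 n X Y s e).trans ?_
      rw [mul_right_comm ((1 / 2 : ℝ) ^ n)]
      gcongr
      exact s.2.2
  -- Comparing the weighted norm with the operator norm costs a factor `exp (α T)`. With `n` large
  -- enough to absorb it, the `n`-th iterate contracts the operator norm itself by `1 / 2`.
  obtain ⟨n, hn⟩ := exists_pow_lt_of_lt_one (show 0 < 1 / 2 * Real.exp (-(α * T)) by positivity)
    (show (1 / 2 : ℝ) < 1 by norm_num)
  have h3 : ContractingWith (1 / 2) Φ^[n] := by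
    refine ⟨by rw [← NNReal.coe_lt_coe]; norm_num, LipschitzWith.of_dist_le_mul fun X Y => ?_⟩
    rw [dist_eq_norm, dist_eq_norm]
    refine (h2 n X Y).trans ?_
    gcongr
    refine (mul_le_mul_of_nonneg_right hn.le (Real.exp_pos _).le).trans_eq ?_
    rw [mul_assoc, ← Real.exp_add, neg_add_cancel, Real.exp_zero]
    norm_num
  refine ⟨_, h3.isFixedPt_fixedPoint_iterate, fun Y hY => ?_⟩
  exact h3.fixedPoint_unique (Function.IsFixedPt.iterate hY n)

end CylindricalProcesses

/-! ### The mild equation as a fixed point problem. -/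

section MildSolution

variable {T : ℝ} {Ω : Type*} {mΩ : MeasurableSpace Ω} {ℱ : Filtration (Set.Icc (0 : ℝ) T) mΩ}
  {P : Measure Ω} {E : Type*} [NormedAddCommGroup E] [NormedSpace ℝ E]

/-- The Bochner integral as a bounded operator on square integrable curves. -/
noncomputable def bochnerL (T : ℝ) (B : Type*) [NormedAddCommGroup B] [NormedSpace ℝ B] :
    Lp B 2 (timeMeasure T) →L[ℝ] B :=
  LinearMap.mkContinuous
    { toFun := fun v => ∫ s, v s ∂(timeMeasure T)
      map_add' := fun v w => by
        rw [← integral_add ((Lp.memLp v).integrable one_le_two)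
          ((Lp.memLp w).integrable one_le_two)]
        exact integral_congr_ae (Lp.coeFn_add v w)
      map_smul' := fun c v => by
        rw [RingHom.id_apply, ← integral_smul]
        exact integral_congr_ae (Lp.coeFn_smul c v) }
    -- The constant of Hölder's inequality between `L¹` and `L²` on a finite measure space.
    ((timeMeasure T Set.univ ^ (1 / (1 : ℝ≥0∞).toReal - 1 / (2 : ℝ≥0∞).toReal)).toReal)
    fun v => by
      refine (norm_integral_le_lintegral_norm _).trans ?_
      rw [mul_comm, Lp.norm_def, ← ENNReal.toReal_mul]
      refine ENNReal.toReal_mono (ENNReal.mul_ne_top (Lp.eLpNorm_ne_top v)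
        (ENNReal.rpow_ne_top_of_nonneg (by norm_num) (measure_ne_top _ _))) ?_
      refine le_trans (le_of_eq ?_) (eLpNorm_le_eLpNorm_mul_rpow_measure_univ one_le_two
        (Lp.aestronglyMeasurable v))
      simp [eLpNorm_one_eq_lintegral_enorm]

lemma bochnerL_apply {B : Type*} [NormedAddCommGroup B] [NormedSpace ℝ B]
    (v : Lp B 2 (timeMeasure T)) : bochnerL T B v = ∫ s, v s ∂(timeMeasure T) := rfl

lemma bochnerL_cutoffL {B : Type*} [NormedAddCommGroup B] [NormedSpace ℝ B]
    (t : Set.Icc (0 : ℝ) T) (ψ : C(Set.Icc (0 : ℝ) T, B)) :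
    bochnerL T B (cutoffL t ψ) = ∫ s in Set.Iic t, ψ s ∂(timeMeasure T) := by
  rw [bochnerL_apply, ← integral_indicator measurableSet_Iic]
  exact integral_congr_ae (cutoffL_coeFn t ψ)

lemma bochnerL_elementaryCurve_mem [IsProbabilityMeasure P] (a b t : Set.Icc (0 : ℝ) T)
    (hab : a ≤ b) (hbt : b ≤ t) (A : Set Ω) (hA : MeasurableSet[ℱ a] A) (u : ℝ) :
    bochnerL T (Lp ℝ 2 P) (elementaryCurve a b (ℱ.le a _ hA) u) ∈ lpMeas ℝ ℝ (ℱ t) 2 P := by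
  rw [bochnerL_apply, elementaryCurve, integral_indicatorConstLp]
  exact Submodule.smul_mem _ _ (mem_lpMeas_indicatorConstLp (ℱ.le t)
    (ℱ.mono (hab.trans hbt) _ hA) (measure_ne_top _ _))

open CylindricalProcess

/-- The process `t ↦ X₀(S_t e)`. -/
noncomputable def initialProcess [CompleteSpace E] (hT : 0 ≤ T) {S : ℝ≥0 → E →L[ℝ] E}
    (hS : IsStronglyContinuousSemigroup S)
    (X₀ : E →L[ℝ] lpMeas ℝ ℝ (ℱ ⟨0, Set.left_mem_Icc.2 hT⟩) 2 P) : CylindricalProcess ℱ P E ℝ :=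
  ofLinear
    (fun t => (((lpMeas ℝ ℝ (ℱ ⟨0, Set.left_mem_Icc.2 hT⟩) 2 P).subtypeL ∘L X₀) ∘L
      S (Real.toNNReal t)).toLinearMap)
    (‖(lpMeas ℝ ℝ (ℱ ⟨0, Set.left_mem_Icc.2 hT⟩) 2 P).subtypeL ∘L X₀‖ * (hS.exists_bound T).choose)
    (mul_nonneg (norm_nonneg _) (hS.exists_bound T).choose_spec.1)
    (fun t e => by
      have h := (hS.exists_bound T).choose_spec
      refine (((lpMeas ℝ ℝ (ℱ ⟨0, Set.left_mem_Icc.2 hT⟩) 2 P).subtypeL ∘L X₀).le_opNorm _).trans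
        ?_
      rw [mul_assoc]
      exact mul_le_mul_of_nonneg_left ((S _).le_of_opNorm_le (h.2 _ t.2.2) e) (norm_nonneg _))
    (fun e => continuous_subtype_val.comp (X₀.continuous.comp ((hS.continuous e).comp
      (continuous_real_toNNReal.comp continuous_subtype_val))))
    fun t e => lpMeas_mono t.2.1 (X₀ (S (Real.toNNReal t) e)).2

lemma initialProcess_eval [CompleteSpace E] (hT : 0 ≤ T) {S : ℝ≥0 → E →L[ℝ] E}
    (hS : IsStronglyContinuousSemigroup S)
    (X₀ : E →L[ℝ] lpMeas ℝ ℝ (ℱ ⟨0, Set.left_mem_Icc.2 hT⟩) 2 P) (t : Set.Icc (0 : ℝ) T) (e : E) :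
    (initialProcess hT hS X₀).eval t e = X₀ (S (Real.toNNReal t) e) := rfl

variable {U : Type*} [NormedAddCommGroup U] [InnerProductSpace ℝ U] [CompleteSpace U]
  {W : Lp U 2 (timeMeasure T) →ₗᵢ[ℝ] Lp ℝ 2 P} [IsProbabilityMeasure P]

lemma itoIntegral_elementaryCurve_mem (hW : IsCylindricalBrownianMotion ℱ P W)
    (a b t : Set.Icc (0 : ℝ) T) (hab : a ≤ b) (hbt : b ≤ t) (A : Set Ω)
    (hA : MeasurableSet[ℱ a] A) (u : U) :
    itoIntegral hW (elementaryCurve a b (ℱ.le a _ hA) u) ∈ lpMeas ℝ ℝ (ℱ t) 2 P := by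
  rw [itoIntegral_elementaryCurve hW hab hA u]
  exact elementaryIntegral_mem_lpMeas hW hab hbt hA u

variable [CompleteSpace E]

/-- The right-hand side of the mild equation. -/
noncomputable def mildMap (hT : 0 ≤ T) (hW : IsCylindricalBrownianMotion ℱ P W)
    {S : ℝ≥0 → E →L[ℝ] E} (hS : IsStronglyContinuousSemigroup S)
    (X₀ : E →L[ℝ] lpMeas ℝ ℝ (ℱ ⟨0, Set.left_mem_Icc.2 hT⟩) 2 P)
    (F : CylindricalProcess ℱ P E ℝ → CylindricalProcess ℱ P E ℝ)
    (G : CylindricalProcess ℱ P E ℝ → CylindricalProcess ℱ P E U)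
    (X : CylindricalProcess ℱ P E ℝ) : CylindricalProcess ℱ P E ℝ :=
  initialProcess hT hS X₀ +
    hS.convolution hT (bochnerL T (Lp ℝ 2 P)) bochnerL_elementaryCurve_mem (F X) +
    hS.convolution hT (itoIntegral hW) (itoIntegral_elementaryCurve_mem hW) (G X)

/-- The existential over `Y` is harmless: the integrand lies in the domain of the Itô integral by
adaptedness, and the isometry determines `Y`. -/
lemma isMildSolution_iff (hT : 0 ≤ T) (hW : IsCylindricalBrownianMotion ℱ P W)
    {S : ℝ≥0 → E →L[ℝ] E} (hS : IsStronglyContinuousSemigroup S)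
    (X₀ : E →L[ℝ] lpMeas ℝ ℝ (ℱ ⟨0, Set.left_mem_Icc.2 hT⟩) 2 P)
    (F : CylindricalProcess ℱ P E ℝ → CylindricalProcess ℱ P E ℝ)
    (G : CylindricalProcess ℱ P E ℝ → CylindricalProcess ℱ P E U)
    (X : CylindricalProcess ℱ P E ℝ) :
    IsMildSolution W S (fun e => (X₀ e : Lp ℝ 2 P)) F G X ↔ mildMap hT hW hS X₀ F G X = X := by
  have heval : ∀ t e, (mildMap hT hW hS X₀ F G X).eval t e =
      X₀ (S (Real.toNNReal t) e) +
        (∫ s in Set.Iic t, (F X).eval s (S (Real.toNNReal (t - s)) e) ∂(timeMeasure T)) +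
        itoIntegral hW (cutoffL t (hS.mildCurve (G X) e t)) := fun t e => by
    rw [mildMap, eval_add, eval_add, initialProcess_eval,
      IsStronglyContinuousSemigroup.convolution_eval,
      IsStronglyContinuousSemigroup.convolution_eval, bochnerL_cutoffL]
    rfl
  have hito : ∀ t e Y, HasItoIntegral ℱ P W ((Set.Iic t).indicator
      fun s => (G X).eval s (S (Real.toNNReal (t - s)) e)) Y ↔
        (cutoffL t (hS.mildCurve (G X) e t), Y) ∈ itoGraph ℱ W := fun t e Y =>
    hasItoIntegral_iff (cutoffL_coeFn t (hS.mildCurve (G X) e t))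
  constructor
  · intro h
    ext1 t e
    obtain ⟨-, Y, hY, hX⟩ := h t e
    rw [hito] at hY
    rw [heval, hX, itoIntegral_eq_of_mem hW hY]
  · intro h t e
    refine ⟨?_, itoIntegral hW (cutoffL t (hS.mildCurve (G X) e t)), ?_, ?_⟩
    · have h1 : Integrable (hS.mildCurve (F X) e t) (timeMeasure T) :=
        Integrable.of_bound (hS.mildCurve (F X) e t).continuous.aestronglyMeasurable _
          (ae_of_all _ (hS.mildCurve (F X) e t).norm_coe_le_norm)
      exact h1.integrableOn
    · rw [hito]
      exact mem_itoGraph_of_mem_itoDomain hW (cutoffL_mem_of_adapted hT (isClosed_itoDomain hW)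
        (fun a b hab _ A hA u => elementaryCurve_mem_itoDomain hab hA u)
        (hS.mildCurve_mem (G X) e t))
    · rw [← heval, h]

theorem existsUnique_isMildSolution (hT : 0 ≤ T) (hW : IsCylindricalBrownianMotion ℱ P W)
    {S : ℝ≥0 → E →L[ℝ] E} (hS : IsStronglyContinuousSemigroup S)
    (X₀ : E →L[ℝ] lpMeas ℝ ℝ (ℱ ⟨0, Set.left_mem_Icc.2 hT⟩) 2 P)
    {F : CylindricalProcess ℱ P E ℝ → CylindricalProcess ℱ P E ℝ}
    {G : CylindricalProcess ℱ P E ℝ → CylindricalProcess ℱ P E U}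
    {LF LG : ℝ≥0} (hF : LipschitzWith LF F) (hG : LipschitzWith LG G)
    (hF' : IsNonAnticipating F) (hG' : IsNonAnticipating G) :
    ∃! X, IsMildSolution W S (fun e => (X₀ e : Lp ℝ 2 P)) F G X := by
  obtain ⟨M, hM0, hM⟩ := hS.exists_bound T
  simp_rw [isMildSolution_iff hT hW hS X₀ F G]
  set C : ℝ := ‖bochnerL T (Lp ℝ 2 P)‖ * M * LF + ‖itoIntegral hW‖ * M * LG with hC
  have hC0 : 0 ≤ C := by positivity
  -- Then `√(2 α) = √(4 C² + 2) ≥ 2 C`, so the contraction factor `C / √(2 α)` is at most `1 / 2`;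
  -- the `+ 1` keeps `α` positive when `C = 0`.
  set α : ℝ := 2 * C ^ 2 + 1 with hα
  have hα0 : 0 < α := by positivity
  have hsq : C / √(2 * α) ≤ 1 / 2 := by
    rw [div_le_iff₀ (by positivity)]
    have : 2 * C ≤ √(2 * α) := Real.le_sqrt_of_sq_le (by rw [hα]; nlinarith)
    linarith
  refine existsUnique_isFixedPt hα0.le fun X Y k hk h t e => ?_
  have hFle := hF'.norm_eval_sub_le hF hk hα0.le h
  have hGle := hG'.norm_eval_sub_le hG hk hα0.le h
  have h1 := hS.norm_convolution_sub_le hT hM0 hM (bochnerL T (Lp ℝ 2 P))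
    bochnerL_elementaryCurve_mem (F X) (F Y) (by positivity) hα0 hFle t e
  have h2 := hS.norm_convolution_sub_le hT hM0 hM (itoIntegral hW)
    (itoIntegral_elementaryCurve_mem hW) (G X) (G Y) (by positivity) hα0 hGle t e
  simp only [mildMap, eval_add]
  rw [add_sub_add_comm, add_sub_add_left_eq_sub]
  refine (norm_add_le _ _).trans ((add_le_add h1 h2).trans ?_)
  calc _ = C / √(2 * α) * (k * Real.exp (α * t) * ‖e‖) := by rw [hC]; ring
    _ ≤ 1 / 2 * (k * Real.exp (α * t) * ‖e‖) := by gcongr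
    _ = _ := by ring

end MildSolution

theorem mainTheorem3 {T : ℝ} (hT : 0 < T) {Ω : Type*} {mΩ : MeasurableSpace Ω}
    (P : Measure Ω) [IsProbabilityMeasure P]
    (ℱ : Filtration (Set.Icc (0 : ℝ) T) mΩ) (hℱ : SatisfiesUsualConditions ℱ P)
    {U : Type*} [NormedAddCommGroup U] [InnerProductSpace ℝ U] [CompleteSpace U]
    [TopologicalSpace.SeparableSpace U]
    (W : Lp U 2 (timeMeasure T) →ₗᵢ[ℝ] Lp ℝ 2 P)
    (hW : IsCylindricalBrownianMotion ℱ P W)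
    (S : ℝ≥0 → C₀(Set.Ioi (0 : ℝ), ℝ) →L[ℝ] C₀(Set.Ioi (0 : ℝ), ℝ))
    (hS : IsStronglyContinuousSemigroup S)
    (X₀ : C₀(Set.Ioi (0 : ℝ), ℝ) →L[ℝ] lpMeas ℝ ℝ (ℱ ⟨0, Set.left_mem_Icc.2 hT.le⟩) 2 P)
    (F : CylindricalProcess ℱ P C₀(Set.Ioi (0 : ℝ), ℝ) ℝ →
      CylindricalProcess ℱ P C₀(Set.Ioi (0 : ℝ), ℝ) ℝ)
    (G : CylindricalProcess ℱ P C₀(Set.Ioi (0 : ℝ), ℝ) ℝ →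
      CylindricalProcess ℱ P C₀(Set.Ioi (0 : ℝ), ℝ) U)
    (hF : ∃ L : ℝ≥0, LipschitzWith L F) (hG : ∃ L : ℝ≥0, LipschitzWith L G)
    (hF' : IsNonAnticipating F) (hG' : IsNonAnticipating G) :
    ∃! X : CylindricalProcess ℱ P C₀(Set.Ioi (0 : ℝ), ℝ) ℝ,
      IsMildSolution W S (fun e => (X₀ e : Lp ℝ 2 P)) F G X := by
  obtain ⟨LF, hLF⟩ := hF
  obtain ⟨LG, hLG⟩ := hG
  exact existsUnique_isMildSolution hT.le hW hS X₀ hLF hLG hF' hG'
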